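/- Theorem 1 (AGM2). Let $\varphi(t)=2^{1/4}e^{-\pi t^2}$, and for $\lambda=(x,\omega)\in\mathbb{R}^2$ let $\pi(\lambda)\varphi(t)=e^{2\pi i\omega t}\varphi(t-x)$. For $\alpha>0$ let $\Lambda(\alpha)=\alpha^{-1/2}\mathbb{Z}\times\alpha^{-1/2}\mathbb{Z}$ be the scaled von Neumann lattice of density $\alpha$, let $$S_{\Lambda(\alpha)}f=\operatorname{vol}(\Lambda(\alpha))\sum_{\lambda\in\Lambda(\alpha)}\langle f,\pi(\lambda)\varphi\rangle\,\pi(\lambda)\varphi,\qquad f\in L^2(\mathbb{R}),$$ be the Gaussian Gabor frame operator normalised by the covolume $\operatorname{vol}(\Lambda(\alpha))$, and let $A(\alpha)$ and $B(\alpha)$ be its sharp spectral bounds, i.e. the largest $A$ and the smallest $B$ such that $$A\|f\|_2^2\le\langle S_{\Lambda(\alpha)}f,f\rangle\le B\|f\|_2^2\qquad\text{for all } f\in L^2(\mathbb{R}).$$ For every integer $n\ge 1$, with $\alpha=2^n$, the series defining $S_{\Lambda(\alpha)}f$ converges unconditionally in $L^2(\mathbb{R})$ for every $f$, the sharp bounds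 exist, and they obey the arithmetic-geometric mean iteration $$B(2^{n+1})=\frac{A(2^n)+B(2^n)}{2},\qquad A(2^{n+1})=\sqrt{A(2^n)\,B(2^n)}.$$ Moreover $B(2)/A(2)=\sqrt2$ and $$A(2)=G=\frac{1}{\mathsf{ag}_2(\sqrt2,1)}=\theta_4(e^{-\pi})^2=0.8346\ldots,$$ where $\mathsf{ag}_2$ is the classical arithmetic-geometric mean, $\theta_4(q)=\sum_{k\in\mathbb{Z}}(-1)^kq^{k^2}$, and $G$ is Gauss' constant, the ratio of the arc length $4\int_0^{\pi/2}\frac{dx}{\sqrt{2(1-\frac12\sin^2x)}}$ of the lemniscate of Bernoulli to the arc length $2\pi$ of the unit circle. -/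

import Mathlib

open MeasureTheory

noncomputable section

namespace GaborAGM

/-- The Hilbert space `L²(ℝ; ℂ)`. -/
abbrev L2 : Type := Lp ℂ 2 (volume : Measure ℝ)

/-- The normalised Gaussian `φ(t) = 2^{1/4} e^{-π t²}`. -/
def gaussian (t : ℝ) : ℂ :=
  (((2 : ℝ) ^ (1 / 4 : ℝ) * Real.exp (-Real.pi * t ^ 2) : ℝ) : ℂ)

/-- The time-frequency shift `(π(x, ω) g)(t) = e^{2πiωt} g(t - x)`, where `z = (x, ω)`. -/
def timeFreqShift (z : ℝ × ℝ) (g : ℝ → ℂ) : ℝ → ℂ :=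
  fun t => Complex.exp (2 * Real.pi * Complex.I * z.2 * t) * g (t - z.1)

theorem memLp_timeFreqShift (z : ℝ × ℝ) {g : ℝ → ℂ} (hg : MemLp g 2) :
    MemLp (timeFreqShift z g) 2 := by
  have h1 : MemLp (fun t => g (t - z.1)) 2 :=
    hg.comp_measurePreserving (measurePreserving_sub_right volume z.1)
  refine h1.of_le ?_ (Filter.Eventually.of_forall fun t => ?_)
  · refine AEStronglyMeasurable.mul ?_ h1.aestronglyMeasurable
    exact Continuous.aestronglyMeasurable (by fun_prop)
  · have h2 : ‖Complex.exp (2 * Real.pi * Complex.I * z.2 * t)‖ = 1 := by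
      have h3 : (2 * Real.pi * Complex.I * z.2 * t : ℂ)
          = ((2 * Real.pi * z.2 * t : ℝ) : ℂ) * Complex.I := by
        push_cast; ring
      rw [h3, Complex.norm_exp_ofReal_mul_I]
    simp only [timeFreqShift, norm_mul, h2, one_mul, le_refl]

theorem memLp_gaussian : MemLp gaussian 2 := by
  have hm : AEStronglyMeasurable gaussian (volume : Measure ℝ) :=
    Continuous.aestronglyMeasurable (by unfold gaussian; fun_prop)
  rw [memLp_two_iff_integrable_sq_norm hm]
  have h := (integrable_exp_neg_mul_sq (b := 2 * Real.pi) (by positivity)).const_mul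
    (((2 : ℝ) ^ (1 / 4 : ℝ)) ^ 2)
  refine h.congr (Filter.Eventually.of_forall fun t => ?_)
  have h0 : 0 ≤ (2 : ℝ) ^ (1 / 4 : ℝ) * Real.exp (-Real.pi * t ^ 2) := by positivity
  simp only [gaussian, Complex.norm_real, Real.norm_of_nonneg h0, mul_pow, ← Real.exp_nat_mul]
  congr 2
  push_cast; ring

/-- The element `π(z) φ` of `L²(ℝ)`. -/
def gaborAtom (z : ℝ × ℝ) : L2 :=
  (memLp_timeFreqShift z memLp_gaussian).toLp (timeFreqShift z gaussian)

/-- The term of the frame expansion at `z`: `⟨f, π(z) φ⟩ π(z) φ`. The inner product of Mathlib is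
conjugate-linear in its first argument. -/
def frameTerm (f : L2) (z : ℝ × ℝ) : L2 :=
  (inner ℂ (gaborAtom z) f : ℂ) • gaborAtom z

/-- The Gaussian Gabor frame operator
`S_Λ f = vol(Λ) ∑_{λ ∈ Λ} ⟨f, π(λ) φ⟩ π(λ) φ` of a lattice `Λ`, normalised by the covolume;
the series is an unconditional sum in `L²(ℝ)`. -/
def frameOperator (Λ : Submodule ℤ (ℝ × ℝ)) (f : L2) : L2 :=
  ZLattice.covolume Λ • ∑' z : Λ, frameTerm f (z : ℝ × ℝ)

/-- All `A` with `A ‖f‖² ≤ ⟨S_Λ f, f⟩` for every `f`. -/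
def lowerBounds (Λ : Submodule ℤ (ℝ × ℝ)) : Set ℝ :=
  {A | ∀ f : L2, A * ‖f‖ ^ 2 ≤ (inner ℂ f (frameOperator Λ f) : ℂ).re}

/-- All `B` with `⟨S_Λ f, f⟩ ≤ B ‖f‖²` for every `f`. -/
def upperBounds (Λ : Submodule ℤ (ℝ × ℝ)) : Set ℝ :=
  {B | ∀ f : L2, (inner ℂ f (frameOperator Λ f) : ℂ).re ≤ B * ‖f‖ ^ 2}

/-- The scaled von Neumann lattice `α^{-1/2} ℤ × α^{-1/2} ℤ` of density `α`. -/
def vonNeumann (α : ℝ) : Submodule ℤ (ℝ × ℝ) :=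
  (Submodule.span ℤ {α ^ (-(1 / 2) : ℝ)}).prod (Submodule.span ℤ {α ^ (-(1 / 2) : ℝ)})

/-- The sharp lower spectral bound of the frame operator over the von Neumann lattice of
density `α`. -/
def specA (α : ℝ) : ℝ := sSup (lowerBounds (vonNeumann α))

/-- The sharp upper spectral bound of the frame operator over the von Neumann lattice of
density `α`. -/
def specB (α : ℝ) : ℝ := sInf (upperBounds (vonNeumann α))

/-- The Jacobi theta constant `θ₄(q) = ∑_{k ∈ ℤ} (-1)^k q^{k²}`. -/
def theta4 (q : ℝ) : ℝ := ∑' k : ℤ, (-1) ^ k * q ^ (k ^ 2)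

/-- The classical arithmetic-geometric mean of `√2` and `1`. -/
def agSqrtTwoOne : ℝ := (NNReal.agm (NNReal.sqrt 2) 1 : ℝ)

/-- Gauss' constant: the arc length
`2ϖ = 4 ∫_0^{π/2} dx / √(2 (1 - sin(x)² / 2))` of the lemniscate of Bernoulli divided by the arc
length `2π` of the unit circle. -/
def gaussConstant : ℝ :=
  (4 * ∫ x in (0 : ℝ)..(Real.pi / 2), 1 / √(2 * (1 - 1 / 2 * Real.sin x ^ 2))) / (2 * Real.pi)

end GaborAGM

end

/-! For density `α = d² = 2N` the frame form is governed twice by one theta function. Sum `|⟨f,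
π(λ)φ⟩|²` over the frequencies by Parseval for the `d`-periodisation of the windowed `f`, then over
the times by Poisson summation. Two Gaussians whose centres lie in `(1/d)ℤ` and differ by `jd` have
their midpoint in `(1/d)ℤ`, because `α` is even. The normalised energy is therefore `∑ q^{j²}
Re⟨Tʲ√w f, √w f⟩`, where `q = e^{-πα/2}`, `T` is translation by `d` and `w(x) = ∑ q^{l²} cos(2πldx)`
(`hasSum_norm_sq_inner_gaborAtom`). The weight `w` is `d`-periodic, so `T` commutes with
multiplication by `√w`.

For `q ≤ 1/16`, both `w` and the theta sum of a unitary operator lie between `θ₄(q)` and `θ₃(q)`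
(`thetaForm_le`, `le_thetaForm`), which gives the bounds `θ₄(q)²` and `θ₃(q)²`. They are sharp: a
narrow bump at an extremum of `w`, summed along its `T`-orbit with constant or alternating signs,
approaches both extremes at once (`exists_thetaForm_near`).

At `α = 2^{n+1}` the nome is `e^{-π2ⁿ}`. Doubling `α` squares it, and the identities
`jtheta_one_sq_add` and `jtheta_one_mul_neg_one` are one step of the arithmetic-geometric mean. The
initial ratio `√2` is `jtheta_lemniscatic`. Since `θ₄² ≤ 1 ≤ θ₃²` and the gap tends to zero, every
quantity squeezed between the two sequences equals `1` (`eq_one_of_between`). Applied to the mean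
itself and to Gauss' elliptic integral, this gives the closed forms at density `2`. -/

noncomputable section

namespace GaborAGM

open Filter Topology

/-! ### Theta constants: the doubling identities and the lemniscatic value -/

/-- The theta series `∑ sᵏ q^{k²}`; `θ₃` for `s = 1` and `θ₄` for `s = -1`. -/
def jtheta (s q : ℝ) : ℝ := ∑' k : ℤ, s ^ k * q ^ (k ^ 2)

theorem summable_sq_mul_zpow_sq {q : ℝ} (h0 : 0 ≤ q) (h1 : q < 1) :
    Summable fun k : ℤ => (k : ℝ) ^ 2 * q ^ (k ^ 2) := by
  have hn : Summable fun n : ℕ => (n : ℝ) ^ 2 * q ^ (n ^ 2) := by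
    refine (summable_pow_mul_geometric_of_norm_lt_one 2
      (by rwa [Real.norm_of_nonneg h0] : ‖q‖ < 1)).of_nonneg_of_le (fun n => by positivity)
      (fun n => ?_)
    exact mul_le_mul_of_nonneg_left
      (pow_le_pow_of_le_one h0 h1.le (Nat.le_self_pow two_ne_zero n)) (by positivity)
  have hc (n : ℕ) : (n : ℝ) ^ 2 * q ^ (n ^ 2) = ((n : ℤ) : ℝ) ^ 2 * q ^ ((n : ℤ) ^ 2) := by
    rw [show ((n : ℤ) ^ 2) = ((n ^ 2 : ℕ) : ℤ) by push_cast; rfl, zpow_natCast]; simp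
  simp_rw [hc] at hn
  refine Summable.of_nat_of_neg hn ?_
  simpa using hn

theorem summable_zpow_sq {q : ℝ} (h0 : 0 ≤ q) (h1 : q < 1) :
    Summable fun k : ℤ => q ^ (k ^ 2) := by
  have h := (summable_sq_mul_zpow_sq h0 h1).add (hasSum_ite_eq (0 : ℤ) (1 : ℝ)).summable
  refine h.of_nonneg_of_le (fun k => zpow_nonneg h0 _) (fun k => ?_)
  rcases eq_or_ne k 0 with rfl | hk
  · simp
  · have h2 : (1 : ℝ) ≤ (k : ℝ) ^ 2 := by
      exact_mod_cast Int.add_one_le_iff.mpr (sq_pos_of_ne_zero hk)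
    simp only [hk, if_false, add_zero]
    exact le_mul_of_one_le_left (zpow_nonneg h0 _) h2

theorem abs_zpow_eq_one {s : ℝ} (hs : s ^ 2 = 1) (k : ℤ) : |s ^ k| = 1 := by
  have : |s| = 1 := by
    rwa [← sq_abs, pow_eq_one_iff_of_nonneg (abs_nonneg s) two_ne_zero] at hs
  rw [abs_zpow, this, one_zpow]

theorem summable_jtheta {s q : ℝ} (hs : s ^ 2 = 1) (h0 : 0 ≤ q) (h1 : q < 1) :
    Summable fun k : ℤ => s ^ k * q ^ (k ^ 2) := by
  refine Summable.of_norm_bounded (summable_zpow_sq h0 h1) (fun k => ?_)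
  rw [norm_mul, Real.norm_eq_abs, abs_zpow_eq_one hs, one_mul, Real.norm_of_nonneg (zpow_nonneg h0 _)]

theorem hasSum_jtheta_mul {s t q : ℝ} (hs : s ^ 2 = 1) (ht : t ^ 2 = 1) (h0 : 0 ≤ q) (h1 : q < 1) :
    HasSum (fun p : ℤ × ℤ => (s ^ p.1 * q ^ (p.1 ^ 2)) * (t ^ p.2 * q ^ (p.2 ^ 2)))
      (jtheta s q * jtheta t q) := by
  have hs' := (summable_jtheta hs h0 h1).norm
  have ht' := (summable_jtheta ht h0 h1).norm
  rw [jtheta, jtheta, tsum_mul_tsum_of_summable_norm hs' ht']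
  exact (summable_mul_of_summable_norm hs' ht').hasSum

/-- Rotation of the square lattice onto the sublattice of even vectors. -/
def rotateLattice (p : ℤ × ℤ) : ℤ × ℤ := (p.1 + p.2, p.1 - p.2)

theorem rotateLattice_injective : Function.Injective rotateLattice := by
  rintro ⟨a, b⟩ ⟨c, d⟩ h
  simp only [rotateLattice, Prod.mk.injEq] at h ⊢
  omega

theorem mem_range_rotateLattice {m n : ℤ} (h : Even (m + n)) :
    (m, n) ∈ Set.range rotateLattice := by
  obtain ⟨k, hk⟩ := h
  exact ⟨(k, k - n), by simp only [rotateLattice, Prod.mk.injEq]; omega⟩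

/-- The rotation is injective with image the vectors of even coordinate sum, so a summand vanishing
on the other coset loses nothing. This is the change of variables in both doubling identities. -/
theorem hasSum_comp_rotateLattice {F : ℤ × ℤ → ℝ} {S : ℝ} (hF : HasSum F S)
    (h : ∀ m n : ℤ, Odd (m + n) → F (m, n) = 0) :
    HasSum (fun p => F (rotateLattice p)) S := by
  refine (rotateLattice_injective.hasSum_iff ?_).mpr hF
  rintro ⟨m, n⟩ hp
  by_contra h0
  exact hp (mem_range_rotateLattice (Int.not_odd_iff_even.mp fun ho => h0 (h m n ho)))

theorem zpow_sq_rotate {q : ℝ} (h0 : 0 < q) (u v : ℤ) :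
    q ^ ((u + v) ^ 2) * q ^ ((u - v) ^ 2) = (q ^ 2) ^ (u ^ 2) * (q ^ 2) ^ (v ^ 2) := by
  rw [← zpow_add₀ h0.ne', ← zpow_natCast, ← zpow_mul, ← zpow_mul, ← zpow_add₀ h0.ne']
  congr 1; push_cast; ring

/-- The double series has coefficients `1 + (-1)^{m+n}`, which vanish on odd vectors. On the even
ones `m² + n² = 2(u² + v²)`, so the nome becomes `q²`. -/
theorem jtheta_one_sq_add {q : ℝ} (h0 : 0 < q) (h1 : q < 1) :
    jtheta 1 q ^ 2 + jtheta (-1) q ^ 2 = 2 * jtheta 1 (q ^ 2) ^ 2 := by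
  have hA := (hasSum_jtheta_mul (one_pow 2) (one_pow 2) h0.le h1).add
    (hasSum_jtheta_mul (s := -1) (t := -1) (by norm_num) (by norm_num) h0.le h1)
  have hB := (hasSum_jtheta_mul (q := q ^ 2) (one_pow 2) (one_pow 2) (by positivity)
    (by nlinarith)).mul_left 2
  have hC := hasSum_comp_rotateLattice hA (fun m n h => by
    have : (-1 : ℝ) ^ m * (-1) ^ n = -1 := by
      rw [← zpow_add₀ (by norm_num), h.neg_one_zpow]
    simp only [one_zpow]
    linear_combination q ^ m ^ 2 * q ^ n ^ 2 * this)
  rw [sq, sq, sq]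
  refine hC.unique (hB.congr_fun ?_)
  rintro ⟨u, v⟩
  have h2 : (-1 : ℝ) ^ (u + v) * (-1) ^ (u - v) = 1 := by
    rw [← zpow_add₀ (by norm_num)]
    exact Even.neg_one_zpow ⟨u, by ring⟩
  simp only [rotateLattice, one_zpow]
  linear_combination 2 * zpow_sq_rotate h0 u v + q ^ ((u + v) ^ 2) * q ^ ((u - v) ^ 2) * h2

/-- The product is expanded in both orders and added: the symmetrised coefficient `(-1)^m + (-1)^n`
vanishes on odd vectors, and equals `2(-1)^{u+v}` on the rotated lattice. -/
theorem jtheta_one_mul_neg_one {q : ℝ} (h0 : 0 < q) (h1 : q < 1) :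
    jtheta 1 q * jtheta (-1) q = jtheta (-1) (q ^ 2) ^ 2 := by
  have hA := (hasSum_jtheta_mul (t := -1) (one_pow 2) (by norm_num) h0.le h1).add
    (hasSum_jtheta_mul (s := -1) (by norm_num) (one_pow 2) h0.le h1)
  have hB := (hasSum_jtheta_mul (s := -1) (t := -1) (q := q ^ 2) (by norm_num) (by norm_num)
    (by positivity) (by nlinarith)).mul_left 2
  have key (m n : ℤ) : (-1 : ℝ) ^ m = (-1) ^ (m + n) * (-1) ^ n := by
    rw [← zpow_add₀ (by norm_num), add_assoc, zpow_add₀ (by norm_num),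
      Even.neg_one_zpow ⟨n, rfl⟩, mul_one]
  have hC := hasSum_comp_rotateLattice hA (fun m n h => by
    have h2 := key m n
    rw [h.neg_one_zpow] at h2
    simp only [one_zpow]
    linear_combination q ^ m ^ 2 * q ^ n ^ 2 * h2)
  have hD := hC.unique (hB.congr_fun ?_)
  · rw [sq]; linarith
  rintro ⟨u, v⟩
  have h1 : (-1 : ℝ) ^ (u + v) = (-1) ^ u * (-1) ^ v := zpow_add₀ (by norm_num) _ _
  have h2 : (-1 : ℝ) ^ (u - v) = (-1) ^ u * (-1) ^ v := by
    rw [zpow_sub₀ (by norm_num)]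
    rcases Int.even_or_odd v with h | h <;> simp [h.neg_one_zpow, div_neg]
  simp only [rotateLattice, one_zpow, h1, h2]
  linear_combination 2 * (-1 : ℝ) ^ u * (-1) ^ v * zpow_sq_rotate h0 u v

theorem one_le_jtheta_one {q : ℝ} (h0 : 0 ≤ q) (h1 : q < 1) : 1 ≤ jtheta 1 q := by
  have h := (summable_jtheta (one_pow 2) h0 h1).le_tsum 0
    (fun k _ => by rw [one_zpow, one_mul]; exact zpow_nonneg h0 _)
  simpa [jtheta] using h

/-- The sign comes from `θ₃θ₄` being a square and `θ₃ ≥ 1`, without the product formula. -/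
theorem jtheta_neg_one_nonneg {q : ℝ} (h0 : 0 < q) (h1 : q < 1) : 0 ≤ jtheta (-1) q := by
  have h := jtheta_one_mul_neg_one h0 h1
  have h2 := one_le_jtheta_one h0.le h1
  by_contra hn
  nlinarith [sq_nonneg (jtheta (-1) (q ^ 2))]

theorem jtheta_neg_one_le {q : ℝ} (h0 : 0 < q) (h1 : q < 1) : jtheta (-1) q ≤ jtheta 1 q := by
  refine (summable_jtheta (by norm_num) h0.le h1).tsum_le_tsum (fun k => ?_)
    (summable_jtheta (by norm_num) h0.le h1)
  refine mul_le_mul_of_nonneg_right ?_ (zpow_nonneg h0.le _)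
  rw [one_zpow]
  exact (le_abs_self _).trans (abs_zpow_eq_one (by norm_num) k).le

/-- Poisson summation exchanges the parameters `2` and `1/2`. -/
theorem jtheta_one_exp_modular :
    jtheta 1 (Real.exp (-Real.pi / 2)) ^ 2 = 2 * jtheta 1 (Real.exp (-2 * Real.pi)) ^ 2 := by
  have h := Real.tsum_exp_neg_mul_int_sq (a := 2) two_pos
  have e1 (c : ℝ) : jtheta 1 (Real.exp c) = ∑' n : ℤ, Real.exp (c * (n : ℝ) ^ 2) := by
    simp only [jtheta, one_zpow, one_mul]
    refine tsum_congr fun n => ?_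
    rw [← Real.rpow_intCast, ← Real.exp_mul]; push_cast; rfl
  rw [e1, e1]
  rw [show -2 * Real.pi = -Real.pi * 2 by ring, h, mul_pow, div_pow, ← Real.sqrt_eq_rpow,
    Real.sq_sqrt two_pos.le]
  ring

/-- Jacobi's identity at the lemniscatic point: `θ₃(e^{-π})⁴ = 2 θ₄(e^{-π})⁴`. -/
theorem jtheta_lemniscatic :
    jtheta 1 (Real.exp (-Real.pi)) ^ 2 = √2 * jtheta (-1) (Real.exp (-Real.pi)) ^ 2 := by
  have hlt {c : ℝ} (hc : c < 0) : Real.exp c < 1 := by simpa using hc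
  have hpi := Real.pi_pos
  have e1 : Real.exp (-Real.pi) = Real.exp (-Real.pi / 2) ^ 2 := by
    rw [← Real.exp_nat_mul]; congr 1; push_cast; ring
  have e2 : Real.exp (-2 * Real.pi) = Real.exp (-Real.pi) ^ 2 := by
    rw [← Real.exp_nat_mul]; congr 1; push_cast; ring
  have h1 := jtheta_one_sq_add (Real.exp_pos (-Real.pi / 2)) (hlt (by linarith))
  have h2 := jtheta_one_mul_neg_one (Real.exp_pos (-Real.pi / 2)) (hlt (by linarith))
  have h3 := jtheta_one_sq_add (Real.exp_pos (-Real.pi)) (hlt (by linarith))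
  rw [← e1] at h1 h2
  rw [← e2] at h3
  have h4 := jtheta_one_exp_modular
  generalize jtheta 1 (Real.exp (-Real.pi / 2)) = x at *
  generalize jtheta (-1) (Real.exp (-Real.pi / 2)) = y at *
  generalize jtheta 1 (Real.exp (-Real.pi)) ^ 2 = B at *
  have hA : 0 ≤ jtheta (-1) (Real.exp (-Real.pi)) ^ 2 := sq_nonneg _
  have hB : 0 ≤ B := by nlinarith [sq_nonneg x, sq_nonneg y]
  generalize jtheta (-1) (Real.exp (-Real.pi)) ^ 2 = A at *
  -- Doubling from `e^{-π}` and the modular relation give `x² = A + B`. Doubling from `e^{-π/2}`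
  -- gives `x² + y² = 2B` and `xy = A`, so `(A + B)(B - A) = A²`.
  have hx : x ^ 2 = A + B := by linarith
  have hy : y ^ 2 = B - A := by linarith
  have : B ^ 2 = 2 * A ^ 2 := by
    have : x ^ 2 * y ^ 2 = A ^ 2 := by rw [← mul_pow, h2]
    rw [hx, hy] at this; linarith
  rw [← Real.sqrt_sq hB, this, Real.sqrt_mul two_pos.le, Real.sqrt_sq hA]

/-! ### Theta sums at small nome -/

/-- The terms at `±1` already contribute `2q`, so the constant `4` says that all others together
weigh no more than these two. Each side is dominated by a geometric series of sum `2q`, through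
`(m+1)² ≤ 4^m`. -/
theorem tsum_sq_mul_zpow_sq_le {q : ℝ} (h0 : 0 ≤ q) (h1 : q ≤ 1 / 16) :
    ∑' k : ℤ, (k : ℝ) ^ 2 * q ^ (k ^ 2) ≤ 4 * q := by
  have hA : HasSum (fun n : ℕ => 2 * q * (1 / 2 : ℝ) ^ n) (4 * q) := by
    have h := hasSum_geometric_two.mul_left (2 * q)
    rwa [show 2 * q * 2 = 4 * q by ring] at h
  have hB : HasSum (fun n : ℕ => 2 * q * (1 / 2 : ℝ) ^ (n + 1)) (2 * q) := by
    have h := hA.mul_left (1 / 2)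
    rw [show 1 / 2 * (4 * q) = 2 * q by ring] at h
    exact h.congr_fun fun n => by rw [pow_succ]; ring
  have hC : HasSum (fun k : ℤ => 2 * q * (1 / 2 : ℝ) ^ k.natAbs) (4 * q + 2 * q) := by
    refine HasSum.of_nat_of_neg_add_one (by simpa using hA) ?_
    convert hB using 4 with n
    omega
  -- The two-sided geometric series has the extra term `2q` at `0`, where the theta term vanishes.
  have hD := (hC.sub (hasSum_ite_eq (0 : ℤ) (2 * q)))
  rw [add_sub_cancel_right] at hD
  rw [← hD.tsum_eq]
  refine (summable_sq_mul_zpow_sq h0 (h1.trans_lt (by norm_num))).tsum_le_tsum (fun k => ?_)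
    hD.summable
  rcases eq_or_ne k 0 with rfl | hk
  · simp
  simp only [hk, if_false, sub_zero]
  obtain ⟨m, hm⟩ : ∃ m, k.natAbs = m + 1 :=
    Nat.exists_eq_succ_of_ne_zero (Int.natAbs_ne_zero.mpr hk)
  have hk2 : k ^ 2 = (((m + 1) ^ 2 : ℕ) : ℤ) := by rw [← hm]; push_cast; rw [sq_abs]
  have hk3 : (k : ℝ) ^ 2 = ((m : ℝ) + 1) ^ 2 := by exact_mod_cast congrArg (Int.cast (R := ℝ)) hk2
  have hpow : ((m : ℝ) + 1) ^ 2 ≤ 4 ^ m := by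
    have : (m : ℝ) + 1 ≤ 2 ^ m := by exact_mod_cast Nat.lt_two_pow_self
    calc ((m : ℝ) + 1) ^ 2 ≤ (2 ^ m) ^ 2 := by gcongr
      _ = 4 ^ m := by rw [← pow_mul, mul_comm, pow_mul]; norm_num
  rw [hm, hk2, hk3, zpow_natCast]
  calc ((m : ℝ) + 1) ^ 2 * q ^ ((m + 1) ^ 2) ≤ 4 ^ m * q ^ (m + 1) := by
        gcongr ?_ * ?_
        exact pow_le_pow_of_le_one h0 (h1.trans (by norm_num)) (Nat.le_self_pow two_ne_zero _)
    _ = q * (4 * q) ^ m := by rw [mul_pow, pow_succ]; ring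
    _ ≤ q * (1 / 2) ^ m := by gcongr; linarith
    _ = 2 * q * (1 / 2) ^ (m + 1) := by rw [pow_succ]; ring

/-- The alternating theta sum of a sequence that grows at most quadratically is dominated by the
terms of index `±1`. -/
theorem tsum_neg_one_zpow_mul_nonpos {q : ℝ} (h0 : 0 ≤ q) (h1 : q ≤ 1 / 16) {δ : ℤ → ℝ}
    (hδ0 : ∀ k, 0 ≤ δ k) (hδ : ∀ k : ℤ, δ k ≤ (k : ℝ) ^ 2 * δ 1) (hδ1 : δ (-1) = δ 1) :
    ∑' k : ℤ, (-1) ^ k * q ^ (k ^ 2) * δ k ≤ 0 := by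
  have hsum := summable_sq_mul_zpow_sq h0 (h1.trans_lt (by norm_num))
  have hle (k : ℤ) : |(-1) ^ k * q ^ (k ^ 2) * δ k| ≤ (k : ℝ) ^ 2 * q ^ (k ^ 2) * δ 1 := by
    rw [abs_mul, abs_mul, abs_zpow_eq_one (by norm_num), one_mul,
      abs_of_nonneg (zpow_nonneg h0 _), abs_of_nonneg (hδ0 k)]
    nlinarith [mul_le_mul_of_nonneg_left (hδ k) (zpow_nonneg h0 (k ^ 2))]
  have hs : Summable fun k : ℤ => (-1) ^ k * q ^ (k ^ 2) * δ k :=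
    Summable.of_norm_bounded (hsum.mul_right (δ 1)) hle
  -- The majorant takes absolute values except at `±1`, where subtracting `2qδ₁` restores the true
  -- value `-qδ₁`.
  have hR := ((hsum.hasSum.mul_right (δ 1)).sub (hasSum_ite_eq (1 : ℤ) (2 * q * δ 1))).sub
    (hasSum_ite_eq (-1 : ℤ) (2 * q * δ 1))
  refine (hs.tsum_le_tsum (fun k => ?_) hR.summable).trans ?_
  · rcases eq_or_ne k 1 with rfl | hk
    · simp; linarith
    rcases eq_or_ne k (-1) with rfl | hk'
    · simp [hδ1]; linarith
    simp only [hk, hk', if_false, sub_zero]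
    exact (le_abs_self _).trans (hle k)
  · rw [hR.tsum_eq]
    nlinarith [mul_le_mul_of_nonneg_right (tsum_sq_mul_zpow_sq_le h0 h1) (hδ0 1)]

/-- Taking `δ` to be the indicator of `k ≠ 0` turns the alternating sum into `θ₄ - 1`. -/
theorem jtheta_neg_one_le_one {q : ℝ} (h0 : 0 ≤ q) (h1 : q ≤ 1 / 16) : jtheta (-1) q ≤ 1 := by
  have h := tsum_neg_one_zpow_mul_nonpos h0 h1 (δ := fun k => if k = 0 then 0 else 1)
    (fun k => by split_ifs <;> norm_num) (fun k => by
      split_ifs with hk h10 h10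
      · simp at h10
      · positivity
      · simp at h10
      · rw [mul_one]
        exact_mod_cast Int.add_one_le_iff.mpr (sq_pos_of_ne_zero hk)) (by simp)
  have hs := (summable_jtheta (s := -1) (by norm_num) h0 (h1.trans_lt (by norm_num))).hasSum.sub
    (hasSum_ite_eq (0 : ℤ) (1 : ℝ))
  have h2 := hs.tsum_eq
  rw [show (fun k : ℤ => (-1 : ℝ) ^ k * q ^ (k ^ 2) - if k = 0 then 1 else 0)
    = fun k => (-1) ^ k * q ^ (k ^ 2) * if k = 0 then 0 else 1 by
      ext k; split_ifs with hk <;> simp [hk]] at h2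
  rw [h2] at h
  rw [jtheta]; linarith

end GaborAGM
end

noncomputable section

namespace GaborAGM

open Filter Topology

/-! ### The sequences of squared theta constants -/

/-- The nome `e^{-π 2^n}`. -/
def nome (n : ℕ) : ℝ := Real.exp (-Real.pi * 2 ^ n)

theorem nome_pos (n : ℕ) : 0 < nome n := Real.exp_pos _

theorem nome_zero : nome 0 = Real.exp (-Real.pi) := by simp [nome]

theorem nome_succ (n : ℕ) : nome (n + 1) = nome n ^ 2 := by
  rw [nome, nome, ← Real.exp_nat_mul]; congr 1; push_cast; ring

/-- The threshold `1/16` is the one needed for the alternating estimates; it holds from density `2`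
on because `e^π ≥ e³ ≥ 2.7³ > 16`. -/
theorem nome_le (n : ℕ) : nome n ≤ 1 / 16 := by
  have h1 : nome n ≤ Real.exp (-3) := by
    refine Real.exp_le_exp.mpr ?_
    have : (1 : ℝ) ≤ 2 ^ n := one_le_pow₀ (by norm_num)
    nlinarith [Real.pi_gt_three]
  have h2 : (2.7 : ℝ) ≤ Real.exp 1 := by linarith [Real.exp_one_gt_d9]
  have h3 : (16 : ℝ) ≤ Real.exp 3 := by
    have : Real.exp 3 = Real.exp 1 ^ 3 := by rw [← Real.exp_nat_mul]; norm_num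
    rw [this]
    calc (16 : ℝ) ≤ 2.7 ^ 3 := by norm_num
      _ ≤ _ := by gcongr
  refine h1.trans ?_
  rw [Real.exp_neg, ← one_div]
  exact one_div_le_one_div_of_le (by norm_num) h3

theorem nome_lt_one (n : ℕ) : nome n < 1 := (nome_le n).trans_lt (by norm_num)

/-- `θ₃(e^{-π 2^n})²`. -/
def upperTheta (n : ℕ) : ℝ := jtheta 1 (nome n) ^ 2

/-- `θ₄(e^{-π 2^n})²`. -/
def lowerTheta (n : ℕ) : ℝ := jtheta (-1) (nome n) ^ 2

theorem lowerTheta_nonneg (n : ℕ) : 0 ≤ lowerTheta n := sq_nonneg _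

theorem one_le_upperTheta (n : ℕ) : 1 ≤ upperTheta n :=
  one_le_pow₀ (one_le_jtheta_one (nome_pos n).le (nome_lt_one n))

theorem upperTheta_succ (n : ℕ) : upperTheta (n + 1) = (lowerTheta n + upperTheta n) / 2 := by
  have h := jtheta_one_sq_add (nome_pos n) (nome_lt_one n)
  rw [← nome_succ] at h
  rw [upperTheta, upperTheta, lowerTheta]
  linarith

theorem lowerTheta_succ (n : ℕ) : lowerTheta (n + 1) = √(lowerTheta n * upperTheta n) := by
  have h := jtheta_one_mul_neg_one (nome_pos n) (nome_lt_one n)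
  rw [← nome_succ] at h
  rw [upperTheta, lowerTheta, lowerTheta, ← mul_pow, mul_comm, h, Real.sqrt_sq (sq_nonneg _)]

theorem lowerTheta_le_upperTheta (n : ℕ) : lowerTheta n ≤ upperTheta n :=
  pow_le_pow_left₀ (jtheta_neg_one_nonneg (nome_pos n) (nome_lt_one n))
    (jtheta_neg_one_le (nome_pos n) (nome_lt_one n)) 2

theorem upperTheta_zero : upperTheta 0 = √2 * lowerTheta 0 := by
  rw [upperTheta, lowerTheta, nome_zero, jtheta_lemniscatic]

theorem lowerTheta_zero_pos : 0 < lowerTheta 0 := by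
  have h := one_le_upperTheta 0
  rw [upperTheta_zero] at h
  have := lowerTheta_nonneg 0
  by_contra hn
  have : lowerTheta 0 = 0 := by linarith
  simp [this] at h
  linarith

theorem lowerTheta_pos (n : ℕ) : 0 < lowerTheta n := by
  induction n with
  | zero => exact lowerTheta_zero_pos
  | succ n ih =>
    rw [lowerTheta_succ]
    exact Real.sqrt_pos.mpr (mul_pos ih (zero_lt_one.trans_le (one_le_upperTheta n)))

theorem lowerTheta_le_succ (n : ℕ) : lowerTheta n ≤ lowerTheta (n + 1) := by
  rw [lowerTheta_succ]
  refine Real.le_sqrt_of_sq_le ?_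
  rw [sq]
  exact mul_le_mul_of_nonneg_left (lowerTheta_le_upperTheta n) (lowerTheta_nonneg n)

/-- The lower sequence increases, so replacing its new term by the old one leaves half the old gap.
-/
theorem upperTheta_sub_lowerTheta_le (n : ℕ) :
    upperTheta n - lowerTheta n ≤ (upperTheta 0 - lowerTheta 0) * (1 / 2) ^ n := by
  induction n with
  | zero => simp
  | succ n ih =>
    rw [pow_succ]
    linarith [lowerTheta_le_succ n, upperTheta_succ n]

theorem lowerTheta_le_one (n : ℕ) : lowerTheta n ≤ 1 :=
  pow_le_one₀ (jtheta_neg_one_nonneg (nome_pos n) (nome_lt_one n))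
    (jtheta_neg_one_le_one (nome_pos n).le (nome_le n))

theorem tendsto_upperTheta_sub_lowerTheta :
    Tendsto (fun n => upperTheta n - lowerTheta n) atTop (𝓝 0) := by
  refine squeeze_zero (fun n => sub_nonneg.mpr (lowerTheta_le_upperTheta n))
    upperTheta_sub_lowerTheta_le ?_
  simpa using (tendsto_pow_atTop_nhds_zero_of_lt_one (r := (1 / 2 : ℝ)) (by norm_num)
    (by norm_num)).const_mul (upperTheta 0 - lowerTheta 0)

/-- A number between all the `θ₄²` and all the `θ₃²` is `1`. -/
theorem eq_one_of_between {c : ℝ} (h1 : ∀ n, lowerTheta n ≤ c) (h2 : ∀ n, c ≤ upperTheta n) :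
    c = 1 := by
  have h : |c - 1| ≤ 0 := by
    refine ge_of_tendsto' tendsto_upperTheta_sub_lowerTheta fun n => ?_
    rw [abs_le]
    constructor <;> linarith [h1 n, h2 n, lowerTheta_le_one n, one_le_upperTheta n]
  linarith [abs_eq_zero.mp (le_antisymm h (abs_nonneg _))]

/-- The mean is unchanged by each step and lies between the two terms at every stage. -/
theorem agm_theta : NNReal.agm (lowerTheta 0).toNNReal (upperTheta 0).toNNReal = 1 := by
  have hstep (n : ℕ) : NNReal.agm (lowerTheta n).toNNReal (upperTheta n).toNNReal
      = NNReal.agm (lowerTheta 0).toNNReal (upperTheta 0).toNNReal := by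
    induction n with
    | zero => rfl
    | succ n ih =>
      rw [← ih, NNReal.agm_eq_agm_gm_am (x := (lowerTheta n).toNNReal)]
      have hu := zero_le_one.trans (one_le_upperTheta n)
      congr 1
      · rw [lowerTheta_succ, ← Real.toNNReal_mul (lowerTheta_nonneg n)]
        apply NNReal.coe_injective
        rw [Real.coe_toNNReal _ (Real.sqrt_nonneg _), Real.coe_sqrt,
          Real.coe_toNNReal _ (mul_nonneg (lowerTheta_nonneg n) hu)]
      · apply NNReal.coe_injective
        have h2 := zero_le_one.trans (one_le_upperTheta (n + 1))
        rw [upperTheta_succ] at h2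
        rw [upperTheta_succ, Real.coe_toNNReal _ h2]
        push_cast
        rw [Real.coe_toNNReal _ (lowerTheta_nonneg n), Real.coe_toNNReal _ hu]
  apply NNReal.coe_injective
  rw [NNReal.coe_one]
  have hmono (n : ℕ) := Real.toNNReal_le_toNNReal (lowerTheta_le_upperTheta n)
  refine eq_one_of_between (fun n => ?_) (fun n => ?_)
  · rw [← hstep n, ← Real.toNNReal_le_iff_le_coe]
    exact (le_min le_rfl (hmono n)).trans NNReal.min_le_agm
  · rw [← hstep n, ← Real.le_toNNReal_iff_coe_le (zero_le_one.trans (one_le_upperTheta n))]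
    exact NNReal.agm_le_max.trans (max_le (hmono n) le_rfl)

/-- Homogeneity of the mean extracts `A` from `agm(A, √2 A) = 1`. -/
theorem lowerTheta_zero_eq_agm : lowerTheta 0 = 1 / agSqrtTwoOne := by
  have h := agm_theta
  rw [upperTheta_zero, Real.toNNReal_mul (Real.sqrt_nonneg 2), mul_comm,
    show NNReal.agm (lowerTheta 0).toNNReal ((lowerTheta 0).toNNReal * (√2).toNNReal)
      = NNReal.agm ((lowerTheta 0).toNNReal * 1) ((lowerTheta 0).toNNReal * (√2).toNNReal) by
      rw [mul_one], NNReal.agm_mul_distrib, NNReal.agm_comm,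
    show (√2).toNNReal = NNReal.sqrt 2 by
      apply NNReal.coe_injective
      rw [Real.coe_toNNReal _ (Real.sqrt_nonneg _), Real.coe_sqrt]; rfl] at h
  have h' := congrArg NNReal.toReal h
  rw [NNReal.coe_mul, Real.coe_toNNReal _ (lowerTheta_nonneg 0), NNReal.coe_one] at h'
  exact eq_one_div_of_mul_eq_one_left h'

/-- No series is evaluated: two steps of the mean express `θ₄²` and `θ₃²` at index `2` as explicit
multiples of the initial value, and these two numbers enclose `1`. -/
theorem lowerTheta_zero_bounds : 0.8346 ≤ lowerTheta 0 ∧ lowerTheta 0 < 0.8347 := by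
  have h0 := lowerTheta_zero_pos
  have s0 : 1.41421 < √2 := Real.lt_sqrt_of_sq_lt (by norm_num)
  have s1 : √2 < 1.41422 := (Real.sqrt_lt' (by norm_num)).mpr (by norm_num)
  have l1 : lowerTheta 1 = √(√2) * lowerTheta 0 := by
    rw [lowerTheta_succ 0, upperTheta_zero, show lowerTheta 0 * (√2 * lowerTheta 0)
      = √2 * lowerTheta 0 ^ 2 by ring, Real.sqrt_mul (Real.sqrt_nonneg 2), Real.sqrt_sq h0.le]
  have t0 : 1.1892 < √(√2) := Real.lt_sqrt_of_sq_lt (by norm_num; linarith)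
  have t1 : √(√2) < 1.18921 := (Real.sqrt_lt' (by norm_num)).mpr (by norm_num; linarith)
  have u1 : upperTheta 1 = (1 + √2) / 2 * lowerTheta 0 := by
    rw [upperTheta_succ 0, upperTheta_zero]; ring
  have u2 := upperTheta_succ 1
  have l2 := lowerTheta_succ 1
  have b1 := one_le_upperTheta 2
  have b2 := lowerTheta_le_one 2
  constructor
  · rw [u2, l1, u1] at b1
    nlinarith
  · rw [l2, l1, u1, Real.sqrt_le_one] at b2
    nlinarith [mul_pos h0 h0, mul_pos (sub_pos.mpr t0) (sub_pos.mpr s0)]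

end GaborAGM
end

noncomputable section

namespace GaborAGM

open Filter Topology

/-! ### Gauss' formula for the elliptic integral -/

/-- The complete elliptic integral `∫_0^{π/2} dx / √(a² cos² x + b² sin² x)`. -/
def ellipticI (a b : ℝ) : ℝ :=
  ∫ x in (0 : ℝ)..(Real.pi / 2), 1 / √(a ^ 2 * Real.cos x ^ 2 + b ^ 2 * Real.sin x ^ 2)

theorem ellipticI_radicand_pos {a b : ℝ} (ha : 0 < a) (hb : 0 < b) (x : ℝ) :
    0 < a ^ 2 * Real.cos x ^ 2 + b ^ 2 * Real.sin x ^ 2 := by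
  rcases eq_or_ne (Real.sin x) 0 with h | h
  · have : Real.cos x ^ 2 = 1 := by have := Real.sin_sq_add_cos_sq x; rw [h] at this; linarith
    rw [h, this]; positivity
  · positivity

theorem continuous_ellipticI_integrand {a b : ℝ} (ha : 0 < a) (hb : 0 < b) :
    Continuous fun x => 1 / √(a ^ 2 * Real.cos x ^ 2 + b ^ 2 * Real.sin x ^ 2) := by
  refine Continuous.div continuous_const (by fun_prop) fun x => ?_
  exact (Real.sqrt_pos.mpr (ellipticI_radicand_pos ha hb x)).ne'

theorem ellipticI_mul {a b c : ℝ} (hc : 0 < c) :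
    ellipticI (c * a) (c * b) = ellipticI a b / c := by
  rw [ellipticI, ellipticI, ← intervalIntegral.integral_div]
  refine intervalIntegral.integral_congr fun x _ => ?_
  rw [show (c * a) ^ 2 * Real.cos x ^ 2 + (c * b) ^ 2 * Real.sin x ^ 2
    = c ^ 2 * (a ^ 2 * Real.cos x ^ 2 + b ^ 2 * Real.sin x ^ 2) by ring,
    Real.sqrt_mul (sq_nonneg c), Real.sqrt_sq hc.le, mul_comm, div_div]

theorem ellipticI_bounds {a b : ℝ} (hb : 0 < b) (h : b ≤ a) :
    Real.pi / 2 / a ≤ ellipticI a b ∧ ellipticI a b ≤ Real.pi / 2 / b := by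
  have ha := hb.trans_le h
  have hint := (continuous_ellipticI_integrand ha hb).intervalIntegrable 0 (Real.pi / 2)
    (μ := volume)
  have hc (c : ℝ) : Real.pi / 2 / c = ∫ _ in (0 : ℝ)..(Real.pi / 2), 1 / c := by
    rw [intervalIntegral.integral_const, smul_eq_mul]; ring
  have hpi : (0 : ℝ) ≤ Real.pi / 2 := by positivity
  have hab : b ^ 2 ≤ a ^ 2 := pow_le_pow_left₀ hb.le h 2
  constructor
  · rw [hc, ellipticI]
    refine intervalIntegral.integral_mono_on hpi (by simp) hint fun x _ => ?_
    refine one_div_le_one_div_of_le (Real.sqrt_pos.mpr (ellipticI_radicand_pos ha hb x)) ?_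
    rw [Real.sqrt_le_left ha.le]
    nlinarith [Real.sin_sq_add_cos_sq x, sq_nonneg (Real.sin x)]
  · rw [hc, ellipticI]
    refine intervalIntegral.integral_mono_on hpi hint (by simp) fun x _ => ?_
    refine one_div_le_one_div_of_le hb ?_
    refine Real.le_sqrt_of_sq_le ?_
    nlinarith [Real.sin_sq_add_cos_sq x, sq_nonneg (Real.cos x)]

/-- Gauss' substitution. -/
def gaussSubst (a b x : ℝ) : ℝ :=
  2 * x + Real.arctan ((b - a) * (Real.sin x * Real.cos x)
    / (a * Real.cos x ^ 2 + b * Real.sin x ^ 2))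

theorem gaussSubst_denom_pos {a b : ℝ} (ha : 0 < a) (hb : 0 < b) (x : ℝ) :
    0 < a * Real.cos x ^ 2 + b * Real.sin x ^ 2 := by
  have := ellipticI_radicand_pos (Real.sqrt_pos.mpr ha) (Real.sqrt_pos.mpr hb) x
  rwa [Real.sq_sqrt ha.le, Real.sq_sqrt hb.le] at this

theorem one_add_gaussSubst_arg_sq {a b : ℝ} (ha : 0 < a) (hb : 0 < b) (x : ℝ) :
    1 + ((b - a) * (Real.sin x * Real.cos x) / (a * Real.cos x ^ 2 + b * Real.sin x ^ 2)) ^ 2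
      = (a ^ 2 * Real.cos x ^ 2 + b ^ 2 * Real.sin x ^ 2)
        / (a * Real.cos x ^ 2 + b * Real.sin x ^ 2) ^ 2 := by
  have hP := (gaussSubst_denom_pos ha hb x).ne'
  have h1 : Real.cos x ^ 2 = 1 - Real.sin x ^ 2 := by linarith [Real.sin_sq_add_cos_sq x]
  field_simp
  simp only [h1]
  ring

/-- The quotient inside the arctangent has a positive denominator, so the substitution is smooth on
the whole line and no branch has to be chosen. -/
theorem hasDerivAt_gaussSubst {a b : ℝ} (ha : 0 < a) (hb : 0 < b) (x : ℝ) :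
    HasDerivAt (gaussSubst a b) ((a + b) * (a * Real.cos x ^ 2 + b * Real.sin x ^ 2)
      / (a ^ 2 * Real.cos x ^ 2 + b ^ 2 * Real.sin x ^ 2)) x := by
  have hP := gaussSubst_denom_pos ha hb x
  have hD := ellipticI_radicand_pos ha hb x
  have hs := Real.hasDerivAt_sin x
  have hc := Real.hasDerivAt_cos x
  have h1 := (((hs.mul hc).const_mul (b - a)).div
    (((hc.pow 2).const_mul a).add ((hs.pow 2).const_mul b)) hP.ne').arctan
  have h2 := ((hasDerivAt_id x).const_mul 2).add h1
  refine h2.congr_deriv ?_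
  simp only [Pi.mul_apply, Pi.pow_apply, Pi.add_apply, Pi.div_apply]
  rw [one_add_gaussSubst_arg_sq ha hb]
  have h1 : Real.cos x ^ 2 = 1 - Real.sin x ^ 2 := by linarith [Real.sin_sq_add_cos_sq x]
  field_simp
  simp only [h1]
  ring_nf
  simp only [h1]
  ring

/-- With `P = a cos² + b sin²` and `D = a² cos² + b² sin²`, the new root is `((a+b)/2)P/√D`. Against
the derivative `(a+b)P/D` it leaves `2/√D`, the original integrand doubled. -/
theorem gaussSubst_radicand {a b : ℝ} (ha : 0 < a) (hb : 0 < b) (x : ℝ) :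
    ((a + b) / 2) ^ 2 * Real.cos (gaussSubst a b x) ^ 2
        + √(a * b) ^ 2 * Real.sin (gaussSubst a b x) ^ 2
      = ((a + b) / 2 * (a * Real.cos x ^ 2 + b * Real.sin x ^ 2)) ^ 2
        / (a ^ 2 * Real.cos x ^ 2 + b ^ 2 * Real.sin x ^ 2) := by
  have hP := gaussSubst_denom_pos ha hb x
  have hD := ellipticI_radicand_pos ha hb x
  have hq := one_add_gaussSubst_arg_sq ha hb x
  have hcos : Real.cos (gaussSubst a b x) ^ 2 = (a * Real.cos x ^ 2 - b * Real.sin x ^ 2) ^ 2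
      / (a ^ 2 * Real.cos x ^ 2 + b ^ 2 * Real.sin x ^ 2) := by
    rw [gaussSubst, Real.cos_add, Real.cos_arctan, Real.sin_arctan, hq, Real.sqrt_div hD.le,
      Real.sqrt_sq hP.le, Real.cos_two_mul, Real.sin_two_mul]
    have hS := Real.sqrt_pos.mpr hD
    have hS2 := Real.sq_sqrt hD.le
    generalize √(a ^ 2 * Real.cos x ^ 2 + b ^ 2 * Real.sin x ^ 2) = S at *
    rw [← hS2, ← div_pow]
    congr 1
    have h1 : Real.cos x ^ 2 = 1 - Real.sin x ^ 2 := by linarith [Real.sin_sq_add_cos_sq x]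
    obtain ⟨P, hPd⟩ : ∃ P, P = a * Real.cos x ^ 2 + b * Real.sin x ^ 2 := ⟨_, rfl⟩
    rw [← hPd] at hP ⊢
    field_simp
    rw [hPd]
    simp only [h1]
    ring
  rw [Real.sin_sq, Real.sq_sqrt (mul_pos ha hb).le, hcos]
  have h1 : Real.cos x ^ 2 = 1 - Real.sin x ^ 2 := by linarith [Real.sin_sq_add_cos_sq x]
  field_simp
  simp only [h1]
  ring

/-- The substitution carries the endpoints `0, π/2` to `0, π`. The new integrand is symmetric about
`π/2`, so both sides appear doubled. -/
theorem ellipticI_gauss {a b : ℝ} (ha : 0 < a) (hb : 0 < b) :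
    ellipticI ((a + b) / 2) √(a * b) = ellipticI a b := by
  have ham : 0 < (a + b) / 2 := by positivity
  have hgm : 0 < √(a * b) := Real.sqrt_pos.mpr (mul_pos ha hb)
  have hcont := continuous_ellipticI_integrand ham hgm
  set g : ℝ → ℝ := fun x => 1 / √(((a + b) / 2) ^ 2 * Real.cos x ^ 2
    + √(a * b) ^ 2 * Real.sin x ^ 2) with hg
  have hsub := intervalIntegral.integral_comp_mul_deriv (a := 0) (b := Real.pi / 2)
    (f := gaussSubst a b) (g := g)
    (fun x _ => hasDerivAt_gaussSubst ha hb x)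
    (Continuous.continuousOn (Continuous.div (by fun_prop) (by fun_prop)
      fun x => (ellipticI_radicand_pos ha hb x).ne')) hcont
  have e0 : gaussSubst a b 0 = 0 := by simp [gaussSubst]
  have e1 : gaussSubst a b (Real.pi / 2) = Real.pi := by simp [gaussSubst]; ring
  rw [e0, e1] at hsub
  have hL : ∫ x in (0 : ℝ)..(Real.pi / 2), (g ∘ gaussSubst a b) x *
      ((a + b) * (a * Real.cos x ^ 2 + b * Real.sin x ^ 2)
      / (a ^ 2 * Real.cos x ^ 2 + b ^ 2 * Real.sin x ^ 2)) = 2 * ellipticI a b := by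
    rw [ellipticI, ← intervalIntegral.integral_const_mul]
    refine intervalIntegral.integral_congr fun x _ => ?_
    have hP := gaussSubst_denom_pos ha hb x
    have hD := ellipticI_radicand_pos ha hb x
    simp only [Function.comp, hg, gaussSubst_radicand ha hb]
    rw [Real.sqrt_div (sq_nonneg _), Real.sqrt_sq (by positivity)]
    have hS := Real.sqrt_pos.mpr hD
    have hS2 := Real.sq_sqrt hD.le
    generalize √(a ^ 2 * Real.cos x ^ 2 + b ^ 2 * Real.sin x ^ 2) = S at *
    rw [← hS2]
    field_simp
  have hR : ∫ x in (0 : ℝ)..Real.pi, g x = 2 * ellipticI ((a + b) / 2) √(a * b) := by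
    rw [← intervalIntegral.integral_add_adjacent_intervals (b := Real.pi / 2)
      (hcont.intervalIntegrable _ _) (hcont.intervalIntegrable _ _), two_mul]
    congr 1
    have := intervalIntegral.integral_comp_sub_left (a := 0) (b := Real.pi / 2) g Real.pi
    rw [sub_zero, show Real.pi - Real.pi / 2 = Real.pi / 2 by ring] at this
    rw [← this]
    refine intervalIntegral.integral_congr fun x _ => ?_
    simp [hg, Real.cos_pi_sub, Real.sin_pi_sub]
  linarith

theorem ellipticI_theta (n : ℕ) :
    ellipticI (upperTheta n) (lowerTheta n) = ellipticI (upperTheta 0) (lowerTheta 0) := by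
  induction n with
  | zero => rfl
  | succ n ih =>
    rw [← ih, ← ellipticI_gauss (zero_lt_one.trans_le (one_le_upperTheta n)) (lowerTheta_pos n),
      upperTheta_succ, lowerTheta_succ, add_comm, mul_comm (lowerTheta n)]

/-- The integral is invariant along the sequence, and `π/2` divided by it lies between the two terms
at every stage, hence equals `1`. Scaling reduces to the pair `(√2, 1)`. -/
theorem lowerTheta_zero_eq_gaussConstant : lowerTheta 0 = gaussConstant := by
  have hpi := Real.pi_pos
  have hx := lowerTheta_zero_pos
  have h1 : Real.pi / 2 / ellipticI (upperTheta 0) (lowerTheta 0) = 1 := by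
    have hpos : 0 < ellipticI (upperTheta 0) (lowerTheta 0) :=
      (div_pos (by positivity) (zero_lt_one.trans_le (one_le_upperTheta 0))).trans_le
        (ellipticI_bounds hx (lowerTheta_le_upperTheta 0)).1
    refine eq_one_of_between (fun n => ?_) (fun n => ?_)
    · have := (ellipticI_bounds (lowerTheta_pos n) (lowerTheta_le_upperTheta n)).2
      rw [ellipticI_theta, le_div_iff₀ (lowerTheta_pos n)] at this
      rw [le_div_iff₀ hpos]; linarith
    · have := (ellipticI_bounds (lowerTheta_pos n) (lowerTheta_le_upperTheta n)).1
      rw [ellipticI_theta, div_le_iff₀ (zero_lt_one.trans_le (one_le_upperTheta n))] at this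
      rw [div_le_iff₀ hpos]; linarith
  have h2 : ellipticI (upperTheta 0) (lowerTheta 0) = ellipticI (√2) 1 / lowerTheta 0 := by
    rw [← ellipticI_mul hx, upperTheta_zero, mul_one, mul_comm]
  have h3 : gaussConstant = 2 / Real.pi * ellipticI (√2) 1 := by
    rw [gaussConstant, ellipticI]
    have : (fun x => 1 / √(2 * (1 - 1 / 2 * Real.sin x ^ 2)))
        = fun x => 1 / √(√2 ^ 2 * Real.cos x ^ 2 + 1 ^ 2 * Real.sin x ^ 2) := by
      ext x
      rw [Real.sq_sqrt two_pos.le, Real.cos_sq']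
      congr 2; ring
    rw [this]
    field_simp
    ring
  rw [h2] at h1
  rw [h3]
  have : ellipticI (√2) 1 ≠ 0 := by
    intro h; simp [h] at h1
  field_simp at h1 ⊢
  linarith

end GaborAGM
end

noncomputable section

namespace GaborAGM

open Filter Topology

/-! ### Theta sums of powers of a unitary operator -/

section Unitary

variable {𝕜 H : Type*} [RCLike 𝕜] [NormedAddCommGroup H] [InnerProductSpace 𝕜 H]

theorem linearIsometryEquiv_mul_apply (U V : H ≃ₗᵢ[𝕜] H) (h : H) : (U * V) h = U (V h) := rfl

theorem norm_sub_zpow_le (V : H ≃ₗᵢ[𝕜] H) (h : H) (j : ℤ) :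
    ‖h - (V ^ j) h‖ ≤ |(j : ℝ)| * ‖h - V h‖ := by
  have hnat (n : ℕ) : ‖h - (V ^ n) h‖ ≤ n * ‖h - V h‖ := by
    induction n with
    | zero => simp
    | succ n ih =>
      have e : h - (V ^ (n + 1)) h = (h - (V ^ n) h) + (V ^ n) (h - V h) := by
        rw [pow_succ, LinearIsometryEquiv.coe_mul, Function.comp_apply, map_sub]; abel
      rw [e]
      refine (norm_add_le _ _).trans ?_
      rw [LinearIsometryEquiv.norm_map]
      push_cast
      linarith
  rcases Int.eq_nat_or_neg j with ⟨n, rfl | rfl⟩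
  · simpa using hnat n
  · have e : ‖h - (V ^ (-(n : ℤ))) h‖ = ‖h - (V ^ n) h‖ := by
      rw [← LinearIsometryEquiv.norm_map (V ^ n), map_sub, ← linearIsometryEquiv_mul_apply,
        ← zpow_natCast, ← zpow_add, add_neg_cancel, zpow_zero, LinearIsometryEquiv.coe_one, id,
        norm_sub_rev]
    rw [e]
    simpa using hnat n

/-- Displacements `‖h - Vʲh‖`, which grow at most linearly in `|j|`, replace the spectral measure of
`V`. -/
theorem re_inner_zpow (V : H ≃ₗᵢ[𝕜] H) (h : H) (j : ℤ) :
    RCLike.re (inner 𝕜 ((V ^ j) h) h) = ‖h‖ ^ 2 - ‖h - (V ^ j) h‖ ^ 2 / 2 := by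
  have := norm_sub_sq (𝕜 := 𝕜) ((V ^ j) h) h
  rw [LinearIsometryEquiv.norm_map, norm_sub_rev] at this
  linarith

/-- `∑ q^{j²} Re ⟨Uʲ h, h⟩`. -/
def thetaForm (q : ℝ) (U : H ≃ₗᵢ[𝕜] H) (h : H) : ℝ :=
  ∑' j : ℤ, q ^ (j ^ 2) * RCLike.re (inner 𝕜 ((U ^ j) h) h)

theorem abs_re_inner_zpow_le (U : H ≃ₗᵢ[𝕜] H) (h : H) (j : ℤ) :
    |RCLike.re (inner 𝕜 ((U ^ j) h) h)| ≤ ‖h‖ ^ 2 := by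
  refine (RCLike.abs_re_le_norm _).trans ((norm_inner_le_norm _ _).trans ?_)
  rw [LinearIsometryEquiv.norm_map, sq]

theorem summable_thetaForm {q : ℝ} (h0 : 0 ≤ q) (h1 : q < 1) (U : H ≃ₗᵢ[𝕜] H) (h : H) :
    Summable fun j : ℤ => q ^ (j ^ 2) * RCLike.re (inner 𝕜 ((U ^ j) h) h) := by
  refine Summable.of_norm_bounded ((summable_zpow_sq h0 h1).mul_right (‖h‖ ^ 2)) fun j => ?_
  rw [norm_mul, Real.norm_of_nonneg (zpow_nonneg h0 _)]
  exact mul_le_mul_of_nonneg_left (abs_re_inner_zpow_le U h j) (zpow_nonneg h0 _)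

theorem thetaForm_le {q : ℝ} (h0 : 0 ≤ q) (h1 : q < 1) (U : H ≃ₗᵢ[𝕜] H) (h : H) :
    thetaForm q U h ≤ jtheta 1 q * ‖h‖ ^ 2 := by
  rw [jtheta, ← tsum_mul_right]
  refine (summable_thetaForm h0 h1 U h).tsum_le_tsum (fun j => ?_)
    ((summable_jtheta (one_pow 2) h0 h1).mul_right _)
  rw [one_zpow, one_mul]
  exact mul_le_mul_of_nonneg_left ((le_abs_self _).trans (abs_re_inner_zpow_le U h j))
    (zpow_nonneg h0 _)

/-- With `V = sU`, near-invariance under `V` describes the part of the spectrum of `U` near `s`, so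
`θ₃` and `θ₄` are treated alike. -/
theorem exists_sign_twist (U : H ≃ₗᵢ[𝕜] H) {s : ℝ} (hs : s ^ 2 = 1) :
    ∃ V : H ≃ₗᵢ[𝕜] H, ∀ (j : ℤ) (h : H), (V ^ j) h = ((s ^ j : ℝ) : 𝕜) • (U ^ j) h := by
  rcases sq_eq_one_iff.mp hs with rfl | rfl
  · exact ⟨U, fun j h => by simp⟩
  · have hc : Commute (LinearIsometryEquiv.neg 𝕜 : H ≃ₗᵢ[𝕜] H) U := by
      ext h; simp
    have hn : (LinearIsometryEquiv.neg 𝕜 : H ≃ₗᵢ[𝕜] H) ^ 2 = 1 := by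
      ext h; simp [sq]
    refine ⟨LinearIsometryEquiv.neg 𝕜 * U, fun j h => ?_⟩
    rw [hc.mul_zpow]
    rcases Int.even_or_odd' j with ⟨k, rfl | rfl⟩
    · rw [zpow_mul, zpow_ofNat, hn, Even.neg_one_zpow ⟨k, by ring⟩]
      simp
    · rw [zpow_add, zpow_mul, zpow_ofNat, hn, Odd.neg_one_zpow ⟨k, rfl⟩]
      simp

theorem thetaForm_eq {q : ℝ} (h0 : 0 ≤ q) (h1 : q < 1) {U V : H ≃ₗᵢ[𝕜] H} {s : ℝ}
    (hs : s ^ 2 = 1) (hV : ∀ (j : ℤ) (h : H), (V ^ j) h = ((s ^ j : ℝ) : 𝕜) • (U ^ j) h) (h : H) :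
    HasSum (fun j : ℤ => s ^ j * q ^ (j ^ 2) * ‖h - (V ^ j) h‖ ^ 2)
      (2 * (jtheta s q * ‖h‖ ^ 2 - thetaForm q U h)) := by
  have hA := ((((summable_jtheta hs h0 h1).hasSum.mul_right (‖h‖ ^ 2)).sub
    (summable_thetaForm h0 h1 U h).hasSum).mul_left 2)
  refine hA.congr_fun fun j => ?_
  have hU : (U ^ j) h = ((s ^ j : ℝ) : 𝕜) • (V ^ j) h := by
    rw [hV, smul_smul, ← RCLike.ofReal_mul, ← sq, ← zpow_natCast, ← zpow_mul, mul_comm j,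
      zpow_mul, zpow_natCast, hs]
    simp
  rw [hU, inner_smul_left, RCLike.conj_ofReal, RCLike.re_ofReal_mul, re_inner_zpow]
  ring

theorem abs_thetaForm_sub_le {q : ℝ} (h0 : 0 ≤ q) (h1 : q < 1) {U V : H ≃ₗᵢ[𝕜] H} {s : ℝ}
    (hs : s ^ 2 = 1) (hV : ∀ (j : ℤ) (h : H), (V ^ j) h = ((s ^ j : ℝ) : 𝕜) • (U ^ j) h) (h : H) :
    |thetaForm q U h - jtheta s q * ‖h‖ ^ 2|
      ≤ (∑' j : ℤ, (j : ℝ) ^ 2 * q ^ (j ^ 2)) * ‖h - V h‖ ^ 2 := by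
  have hA := thetaForm_eq h0 h1 hs hV h
  have hB := (summable_sq_mul_zpow_sq h0 h1).hasSum.mul_right (‖h - V h‖ ^ 2)
  have hle (j : ℤ) : ‖s ^ j * q ^ (j ^ 2) * ‖h - (V ^ j) h‖ ^ 2‖
      ≤ (j : ℝ) ^ 2 * q ^ (j ^ 2) * ‖h - V h‖ ^ 2 := by
    have h2 := pow_le_pow_left₀ (norm_nonneg _) (norm_sub_zpow_le V h j) 2
    rw [mul_pow, sq_abs] at h2
    rw [norm_mul, norm_mul, Real.norm_eq_abs, abs_zpow_eq_one hs, one_mul,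
      Real.norm_of_nonneg (zpow_nonneg h0 _), Real.norm_of_nonneg (sq_nonneg _)]
    nlinarith [mul_le_mul_of_nonneg_left h2 (zpow_nonneg h0 (j ^ 2))]
  have h3 := tsum_of_norm_bounded hB hle
  rw [hA.tsum_eq, Real.norm_eq_abs, abs_mul, abs_two, abs_sub_comm] at h3
  linarith [abs_nonneg (thetaForm q U h - jtheta s q * ‖h‖ ^ 2)]

/-- For `V = -U` the defect from `θ₄‖h‖²` is an alternating sum of `‖h - Vʲh‖² ≤ j²‖h - Vh‖²`, so
the terms at `±1` decide its sign. -/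
theorem le_thetaForm {q : ℝ} (h0 : 0 ≤ q) (h1 : q ≤ 1 / 16) (U : H ≃ₗᵢ[𝕜] H) (h : H) :
    jtheta (-1) q * ‖h‖ ^ 2 ≤ thetaForm q U h := by
  obtain ⟨V, hV⟩ := exists_sign_twist U (s := -1) (by norm_num)
  have hA := (thetaForm_eq h0 (h1.trans_lt (by norm_num)) (by norm_num) hV h).tsum_eq
  have hB := tsum_neg_one_zpow_mul_nonpos h0 h1 (δ := fun j => ‖h - (V ^ j) h‖ ^ 2)
    (fun j => by positivity) (fun j => by
      have h2 := pow_le_pow_left₀ (norm_nonneg _) (norm_sub_zpow_le V h j) 2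
      rwa [mul_pow, sq_abs] at h2) (by
      have e : ‖h - (V ^ (-1 : ℤ)) h‖ = ‖h - (V ^ (1 : ℤ)) h‖ := by
        rw [← LinearIsometryEquiv.norm_map (V ^ (1 : ℤ)), map_sub,
          ← linearIsometryEquiv_mul_apply, ← zpow_add, add_neg_cancel, zpow_zero,
          LinearIsometryEquiv.coe_one, id, norm_sub_rev]
      simp only [e])
  rw [hA] at hB
  linarith

theorem norm_sq_sum_pow (V : H ≃ₗᵢ[𝕜] H) {v : H}
    (hv : ∀ j : ℤ, j ≠ 0 → inner 𝕜 ((V ^ j) v) v = 0) (N : ℕ) :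
    ‖∑ i ∈ Finset.range N, (V ^ i) v‖ ^ 2 = N * ‖v‖ ^ 2 := by
  induction N with
  | zero => simp
  | succ N ih =>
    have hz : inner 𝕜 (∑ i ∈ Finset.range N, (V ^ i) v) ((V ^ N) v) = 0 := by
      rw [sum_inner]
      refine Finset.sum_eq_zero fun i hi => ?_
      have h1 := hv ((i : ℤ) - N) (by have := Finset.mem_range.mp hi; omega)
      rw [← LinearIsometryEquiv.inner_map_map (V ^ N), ← linearIsometryEquiv_mul_apply,
        ← zpow_natCast, ← zpow_add] at h1
      rw [← h1]; congr 2
      simp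
    rw [Finset.sum_range_succ, sq, norm_add_sq_eq_norm_sq_add_norm_sq_of_inner_eq_zero _ _ hz,
      ← sq, ih, LinearIsometryEquiv.norm_map]
    push_cast; ring

/-- The difference telescopes to `v - Vᴺv`. For a wandering vector the orbit sum has norm `√N ‖v‖`,
so it becomes almost invariant relative to its size. -/
theorem norm_sub_sum_pow_le (V : H ≃ₗᵢ[𝕜] H) (v : H) (N : ℕ) :
    ‖∑ i ∈ Finset.range N, (V ^ i) v - V (∑ i ∈ Finset.range N, (V ^ i) v)‖ ≤ 2 * ‖v‖ := by
  have e : ∑ i ∈ Finset.range N, (V ^ i) v - V (∑ i ∈ Finset.range N, (V ^ i) v)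
      = v - (V ^ N) v := by
    rw [map_sum, ← Finset.sum_sub_distrib]
    have h := Finset.sum_range_sub' (fun i => (V ^ i) v) N
    simp only [pow_zero, LinearIsometryEquiv.coe_one, id] at h
    rw [← h]
    refine Finset.sum_congr rfl fun i _ => ?_
    rw [pow_succ', linearIsometryEquiv_mul_apply]
  rw [e]
  refine (norm_sub_le _ _).trans ?_
  rw [LinearIsometryEquiv.norm_map]; linarith

/-- The theta form of long orbit sums of a wandering vector approaches the value of the theta
function at the sign `s`. -/
theorem abs_thetaForm_sum_pow_sub_le {q : ℝ} (h0 : 0 ≤ q) (h1 : q < 1) {U V : H ≃ₗᵢ[𝕜] H} {s : ℝ}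
    (hs : s ^ 2 = 1) (hV : ∀ (j : ℤ) (h : H), (V ^ j) h = ((s ^ j : ℝ) : 𝕜) • (U ^ j) h) {v : H}
    (hv : ∀ j : ℤ, j ≠ 0 → inner 𝕜 ((U ^ j) v) v = 0) (N : ℕ) :
    |thetaForm q U (∑ i ∈ Finset.range N, (V ^ i) v) - jtheta s q * (N * ‖v‖ ^ 2)|
      ≤ (∑' j : ℤ, (j : ℝ) ^ 2 * q ^ (j ^ 2)) * (4 * ‖v‖ ^ 2) := by
  have hvV : ∀ j : ℤ, j ≠ 0 → inner 𝕜 ((V ^ j) v) v = 0 := fun j hj => by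
    rw [hV, inner_smul_left, hv j hj, mul_zero]
  rw [← norm_sq_sum_pow V hvV]
  refine (abs_thetaForm_sub_le h0 h1 hs hV _).trans ?_
  have h2 := pow_le_pow_left₀ (norm_nonneg _) (norm_sub_sum_pow_le V v N) 2
  refine mul_le_mul_of_nonneg_left (h2.trans_eq (by ring)) (tsum_nonneg fun j => ?_)
  exact mul_nonneg (sq_nonneg _) (zpow_nonneg h0 _)

end Unitary

end GaborAGM
end

noncomputable section

namespace GaborAGM

open Filter Topology

/-! ### The periodised Gaussian weight -/

/-- The nome `e^{-π d² / 2}`. -/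
def sqNome (d : ℝ) : ℝ := Real.exp (-Real.pi * d ^ 2 / 2)

theorem sqNome_pos (d : ℝ) : 0 < sqNome d := Real.exp_pos _

theorem sqNome_lt_one {d : ℝ} (hd : 0 < d) : sqNome d < 1 := by
  rw [sqNome, Real.exp_lt_one_iff]
  have := Real.pi_pos
  have : 0 < Real.pi * d ^ 2 := by positivity
  linarith

/-- The real theta function `∑ q^{l²} cos (2 π l d x)`. -/
def weight (d x : ℝ) : ℝ :=
  ∑' l : ℤ, sqNome d ^ (l ^ 2) * Real.cos (l * (2 * Real.pi * d * x))

theorem re_inner_rotation_zpow (t : ℝ) (j : ℤ) :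
    RCLike.re (inner ℝ (((rotation (Circle.exp t)) ^ j : ℂ ≃ₗᵢ[ℝ] ℂ) 1) (1 : ℂ)) =
      Real.cos (j * t) := by
  rw [← map_zpow, rotation_apply, Complex.inner]
  rw [← Circle.exp_intCast_mul, Circle.coe_exp, mul_one, ← Complex.conj_re, map_mul, map_one,
    Complex.conj_conj, one_mul, Complex.exp_ofReal_mul_I_re, RCLike.re_to_real]

/-- A cosine series is the theta form of a plane rotation at `1`, with `ℂ` as a real Hilbert space;
the bounds for operators thus also bound the weight. -/
theorem weight_eq_thetaForm (d x : ℝ) :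
    weight d x = thetaForm (sqNome d)
      (rotation (Circle.exp (2 * Real.pi * d * x)) : ℂ ≃ₗᵢ[ℝ] ℂ) 1 := by
  rw [weight, thetaForm]
  exact tsum_congr fun l => by rw [re_inner_rotation_zpow]

theorem weight_le {d : ℝ} (hd : 0 < d) (x : ℝ) : weight d x ≤ jtheta 1 (sqNome d) := by
  have h := thetaForm_le (sqNome_pos d).le (sqNome_lt_one hd)
      (rotation (Circle.exp (2 * Real.pi * d * x)) : ℂ ≃ₗᵢ[ℝ] ℂ) 1
  rwa [← weight_eq_thetaForm, norm_one, one_pow, mul_one] at h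

theorem le_weight {d : ℝ} (hq : sqNome d ≤ 1 / 16) (x : ℝ) :
    jtheta (-1) (sqNome d) ≤ weight d x := by
  have h := le_thetaForm (sqNome_pos d).le hq
      (rotation (Circle.exp (2 * Real.pi * d * x)) : ℂ ≃ₗᵢ[ℝ] ℂ) 1
  rwa [← weight_eq_thetaForm, norm_one, one_pow, mul_one] at h

theorem weight_zero (d : ℝ) : weight d 0 = jtheta 1 (sqNome d) := by
  simp [weight, jtheta]

theorem weight_half {d : ℝ} (hd : 0 < d) : weight d (1 / (2 * d)) = jtheta (-1) (sqNome d) := by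
  rw [weight, jtheta]
  refine tsum_congr fun l => ?_
  rw [show (l : ℝ) * (2 * Real.pi * d * (1 / (2 * d))) = l * Real.pi by field_simp,
    Real.cos_int_mul_pi, mul_comm]

theorem weight_add_div {d : ℝ} (hd : 0 < d) (x : ℝ) (j : ℤ) :
    weight d (x + j / d) = weight d x := by
  refine tsum_congr fun l => ?_
  rw [show (l : ℝ) * (2 * Real.pi * d * (x + j / d))
    = l * (2 * Real.pi * d * x) + (l * j : ℤ) * (2 * Real.pi) by push_cast; field_simp,
    Real.cos_add_int_mul_two_pi]

theorem continuous_weight {d : ℝ} (hd : 0 < d) : Continuous (weight d) := by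
  refine continuous_tsum (fun l => by fun_prop)
    (summable_zpow_sq (sqNome_pos d).le (sqNome_lt_one hd)) fun l x => ?_
  rw [norm_mul, Real.norm_of_nonneg (zpow_nonneg (sqNome_pos d).le _)]
  exact mul_le_of_le_one_right (zpow_nonneg (sqNome_pos d).le _) (Real.abs_cos_le_one _)

theorem summable_gaussian_translates {d : ℝ} (hd : 0 < d) (x : ℝ) :
    Summable fun k : ℤ => Real.exp (-2 * Real.pi * (x - k / d) ^ 2) := by
  have hpi := Real.pi_pos
  have hr : Real.exp (-Real.pi / d ^ 2) < 1 := by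
    rw [Real.exp_lt_one_iff]; exact div_neg_of_neg_of_pos (by linarith) (by positivity)
  refine ((summable_zpow_sq (Real.exp_pos _).le hr).mul_left
    (Real.exp (2 * Real.pi * x ^ 2))).of_nonneg_of_le (fun k => (Real.exp_pos _).le) fun k => ?_
  rw [← Real.rpow_intCast, ← Real.exp_mul, ← Real.exp_add, Real.exp_le_exp]
  have : -Real.pi / d ^ 2 * ((k ^ 2 : ℤ) : ℝ) = -Real.pi * (k / d) ^ 2 := by
    push_cast; field_simp
  rw [this]
  nlinarith [sq_nonneg (2 * x - k / d), mul_nonneg hpi.le (sq_nonneg (2 * x - k / d))]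

/-- Poisson summation for the weight. -/
theorem hasSum_weight {d : ℝ} (hd : 0 < d) (x : ℝ) :
    HasSum (fun k : ℤ => √2 / d * Real.exp (-2 * Real.pi * (x - k / d) ^ 2)) (weight d x) := by
  have hs := (summable_gaussian_translates hd x).mul_left (√2 / d)
  -- The linear coefficient `i d x` produces the oscillation `e^{2πindx}` on one side and centres
  -- the dual Gaussians at `n/d` on the other.
  have hP := Complex.tsum_exp_neg_quadratic (a := ((d ^ 2 / 2 : ℝ) : ℂ))
    (by rw [Complex.ofReal_re]; positivity) (Complex.I * (d * x : ℝ))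
  have hR : ∑' n : ℤ, Complex.exp (-Real.pi / ((d ^ 2 / 2 : ℝ) : ℂ)
        * (n + Complex.I * (Complex.I * (d * x : ℝ))) ^ 2)
      = ((∑' k : ℤ, Real.exp (-2 * Real.pi * (x - k / d) ^ 2) : ℝ) : ℂ) := by
    rw [Complex.ofReal_tsum]
    refine tsum_congr fun n => ?_
    rw [Complex.ofReal_exp, ← mul_assoc Complex.I, Complex.I_mul_I]
    congr 1
    have hd' : (d : ℂ) ≠ 0 := by exact_mod_cast hd.ne'
    push_cast
    field_simp
    ring
  have hc : (1 : ℂ) / ((d ^ 2 / 2 : ℝ) : ℂ) ^ (1 / 2 : ℂ) = ((√2 / d : ℝ) : ℂ) := by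
    rw [show (1 / 2 : ℂ) = ((1 / 2 : ℝ) : ℂ) by push_cast; rfl,
      ← Complex.ofReal_cpow (by positivity), ← Real.sqrt_eq_rpow, Real.sqrt_div (sq_nonneg d),
      Real.sqrt_sq hd.le, ← Complex.ofReal_one, ← Complex.ofReal_div, one_div_div]
  have hL (n : ℤ) : Complex.exp (-Real.pi * ((d ^ 2 / 2 : ℝ) : ℂ) * (n : ℂ) ^ 2
      + 2 * Real.pi * (Complex.I * (d * x : ℝ)) * n)
      = ((sqNome d ^ (n ^ 2) : ℝ) : ℂ)
        * Complex.exp ((n * (2 * Real.pi * d * x) : ℝ) * Complex.I) := by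
    rw [sqNome, ← Real.rpow_intCast, ← Real.exp_mul, Complex.ofReal_exp, ← Complex.exp_add]
    congr 1
    push_cast
    ring
  rw [hR, hc, ← Complex.ofReal_mul, tsum_congr hL] at hP
  have hsum : Summable fun n : ℤ => ((sqNome d ^ (n ^ 2) : ℝ) : ℂ)
      * Complex.exp ((n * (2 * Real.pi * d * x) : ℝ) * Complex.I) := by
    refine Summable.of_norm_bounded (summable_zpow_sq (sqNome_pos d).le (sqNome_lt_one hd))
      fun n => ?_
    rw [norm_mul, Complex.norm_exp_ofReal_mul_I, mul_one, Complex.norm_real,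
      Real.norm_of_nonneg (zpow_nonneg (sqNome_pos d).le _)]
  have hre := congrArg Complex.re hP
  rw [Complex.re_tsum hsum, Complex.ofReal_re] at hre
  have hw : weight d x = √2 / d * ∑' k : ℤ, Real.exp (-2 * Real.pi * (x - k / d) ^ 2) := by
    rw [← hre, weight]
    refine tsum_congr fun n => ?_
    rw [Complex.re_ofReal_mul, Complex.exp_ofReal_mul_I_re]
  rw [hw, ← tsum_mul_left]
  exact hs.hasSum

/-! ### Translations and multiplication operators on `L²(ℝ)` -/

/-- The translation `f ↦ f(· + y)` of `L²(ℝ)`. -/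
def translate (y : ℝ) : L2 ≃ₗᵢ[ℂ] L2 :=
  LinearIsometryEquiv.ofSurjective
    (Lp.compMeasurePreservingₗᵢ ℂ (fun x : ℝ => x + y) (measurePreserving_add_right volume y))
    fun f => by
      refine ⟨Lp.compMeasurePreserving (fun x : ℝ => x + -y)
        (measurePreserving_add_right volume (-y)) f, ?_⟩
      change Lp.compMeasurePreserving _ (measurePreserving_add_right volume y)
        (Lp.compMeasurePreserving _ (measurePreserving_add_right volume (-y)) f) = f
      refine Lp.ext ?_
      have hA := Lp.coeFn_compMeasurePreserving f (measurePreserving_add_right volume (-y))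
      filter_upwards [Lp.coeFn_compMeasurePreserving (Lp.compMeasurePreserving _
        (measurePreserving_add_right volume (-y)) f) (measurePreserving_add_right volume y),
        (measurePreserving_add_right volume y).quasiMeasurePreserving.ae hA] with x h1 h2
      rw [h1, Function.comp_apply, h2]
      simp

theorem coeFn_translate (y : ℝ) (f : L2) : translate y f =ᵐ[volume] fun x => f (x + y) :=
  Lp.coeFn_compMeasurePreserving f (measurePreserving_add_right volume y)

theorem translate_add (y z : ℝ) : translate (y + z) = translate y * translate z := by
  ext1 f
  refine Lp.ext ?_
  rw [linearIsometryEquiv_mul_apply]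
  filter_upwards [coeFn_translate (y + z) f, coeFn_translate y (translate z f),
    (measurePreserving_add_right volume y).quasiMeasurePreserving.ae (coeFn_translate z f)]
    with x h1 h2 h3
  rw [h1, h2, h3, add_assoc]

/-- Translations as a group homomorphism. -/
def translateHom : Multiplicative ℝ →* (L2 ≃ₗᵢ[ℂ] L2) :=
  MonoidHom.mk' (fun y => translate y.toAdd) fun _ _ => translate_add _ _

theorem translate_zpow (y : ℝ) (j : ℤ) : translate y ^ j = translate (j * y) := by
  have h := map_zpow translateHom (Multiplicative.ofAdd y) j
  rw [← ofAdd_zsmul, zsmul_eq_mul] at h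
  exact h.symm

theorem memLp_ofReal_mul {m : ℝ → ℝ} (hm : Continuous m) {C : ℝ} (hC : ∀ x, |m x| ≤ C) (f : L2) :
    MemLp (fun x => (m x : ℂ) * f x) 2 := by
  refine (Lp.memLp f).of_le_mul (c := C) ?_ (ae_of_all _ fun x => ?_)
  · exact (Continuous.aestronglyMeasurable (by fun_prop)).mul (Lp.aestronglyMeasurable f)
  · rw [norm_mul, Complex.norm_real, Real.norm_eq_abs]
    exact mul_le_mul_of_nonneg_right (hC x) (norm_nonneg _)

/-- Multiplication by a bounded continuous function on `L²(ℝ)`. -/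
def mulBdd (m : ℝ → ℝ) (hm : Continuous m) (C : ℝ) (hC : ∀ x, |m x| ≤ C) : L2 →ₗ[ℂ] L2 where
  toFun f := (memLp_ofReal_mul hm hC f).toLp _
  map_add' f g := by
    refine Lp.ext ?_
    filter_upwards [(memLp_ofReal_mul hm hC (f + g)).coeFn_toLp, Lp.coeFn_add f g,
      Lp.coeFn_add ((memLp_ofReal_mul hm hC f).toLp _) ((memLp_ofReal_mul hm hC g).toLp _),
      (memLp_ofReal_mul hm hC f).coeFn_toLp, (memLp_ofReal_mul hm hC g).coeFn_toLp]
      with x h1 h2 h3 h4 h5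
    rw [h1, h3, Pi.add_apply, h4, h5, h2, Pi.add_apply, mul_add]
  map_smul' c f := by
    refine Lp.ext ?_
    filter_upwards [(memLp_ofReal_mul hm hC (c • f)).coeFn_toLp, Lp.coeFn_smul c f,
      Lp.coeFn_smul c ((memLp_ofReal_mul hm hC f).toLp _),
      (memLp_ofReal_mul hm hC f).coeFn_toLp] with x h1 h2 h3 h4
    rw [RingHom.id_apply, h1, h3, Pi.smul_apply, h4, h2, Pi.smul_apply, smul_eq_mul, smul_eq_mul]
    ring

theorem coeFn_mulBdd {m : ℝ → ℝ} (hm : Continuous m) {C : ℝ} (hC : ∀ x, |m x| ≤ C) (f : L2) :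
    mulBdd m hm C hC f =ᵐ[volume] fun x => (m x : ℂ) * f x :=
  (memLp_ofReal_mul hm hC f).coeFn_toLp

theorem mulBdd_translate {m : ℝ → ℝ} (hm : Continuous m) {C : ℝ} (hC : ∀ x, |m x| ≤ C) {y : ℝ}
    (hy : ∀ x, m (x + y) = m x) (f : L2) :
    mulBdd m hm C hC (translate y f) = translate y (mulBdd m hm C hC f) := by
  refine Lp.ext ?_
  filter_upwards [coeFn_mulBdd hm hC (translate y f), coeFn_translate y f,
    coeFn_translate y (mulBdd m hm C hC f),
    (measurePreserving_add_right volume y).quasiMeasurePreserving.ae (coeFn_mulBdd hm hC f)]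
    with x h1 h2 h3 h4
  rw [h1, h2, h3, h4, hy]

theorem norm_sq_eq_integral (f : L2) : ‖f‖ ^ 2 = ∫ x, ‖f x‖ ^ 2 := by
  rw [← inner_self_eq_norm_sq (𝕜 := ℂ), L2.inner_def, ← integral_re]
  · refine integral_congr_ae (ae_of_all _ fun x => ?_)
    simp only
    rw [inner_self_eq_norm_sq]
  · exact L2.integrable_inner f f

theorem norm_mulBdd_sq {m : ℝ → ℝ} (hm : Continuous m) {C : ℝ} (hC : ∀ x, |m x| ≤ C) (f : L2) :
    ‖mulBdd m hm C hC f‖ ^ 2 = ∫ x, m x ^ 2 * ‖f x‖ ^ 2 := by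
  rw [norm_sq_eq_integral]
  refine integral_congr_ae ?_
  filter_upwards [coeFn_mulBdd hm hC f] with x h1
  rw [h1, norm_mul, Complex.norm_real, mul_pow, Real.norm_eq_abs, sq_abs]

end GaborAGM
end

noncomputable section

namespace GaborAGM

open Filter Topology
open scoped ENNReal ComplexConjugate

/-! ### Periodisation and Parseval's identity -/

theorem Ioc_zsmul_eq_preimage (d : ℝ) (n : ℤ) :
    Set.Ioc (n • d) ((n + 1) • d) = (fun x => x - n * d) ⁻¹' Set.Ioc 0 d := by
  ext x
  simp only [Set.mem_Ioc, Set.mem_preimage, zsmul_eq_mul]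
  push_cast
  constructor <;> rintro ⟨h1, h2⟩ <;> constructor <;> linarith

theorem lintegral_Ioc_unfold {d : ℝ} (hd : 0 < d) (h : ℝ → ℝ≥0∞) :
    ∫⁻ x, h x = ∑' j : ℤ, ∫⁻ x in Set.Ioc 0 d, h (x + j * d) := by
  rw [← setLIntegral_univ, ← iUnion_Ioc_zsmul hd,
    lintegral_iUnion (fun _ => measurableSet_Ioc) (Set.pairwise_disjoint_Ioc_zsmul d)]
  refine tsum_congr fun n => ?_
  rw [Ioc_zsmul_eq_preimage]
  have := (measurePreserving_sub_right volume ((n : ℝ) * d)).setLIntegral_comp_preimage_emb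
    (MeasurableEquiv.subRight ((n : ℝ) * d)).measurableEmbedding (fun x => h (x + n * d))
    (Set.Ioc 0 d)
  simpa using this

theorem hasSum_integral_Ioc_unfold {d : ℝ} (hd : 0 < d) {h : ℝ → ℂ} (hh : Integrable h) :
    HasSum (fun j : ℤ => ∫ x in Set.Ioc 0 d, h (x + j * d)) (∫ x, h x) := by
  have h1 := hasSum_integral_iUnion (μ := volume) (f := h)
    (fun n : ℤ => measurableSet_Ioc (a := n • d) (b := (n + 1) • d))
    (Set.pairwise_disjoint_Ioc_zsmul d) (by rw [iUnion_Ioc_zsmul hd]; exact hh.integrableOn)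
  rw [iUnion_Ioc_zsmul hd, setIntegral_univ] at h1
  refine h1.congr_fun fun n => ?_
  rw [Ioc_zsmul_eq_preimage]
  have := (measurePreserving_sub_right volume ((n : ℝ) * d)).setIntegral_preimage_emb
    (MeasurableEquiv.subRight ((n : ℝ) * d)).measurableEmbedding (fun x => h (x + n * d))
    (Set.Ioc 0 d)
  simpa using this.symm

theorem integral_Ioc_tsum {d : ℝ} (hd : 0 < d) {h : ℝ → ℂ} (hh : Integrable h) :
    ∫ x in Set.Ioc 0 d, ∑' j : ℤ, h (x + j * d) = ∫ x, h x := by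
  rw [integral_tsum]
  · exact (hasSum_integral_Ioc_unfold hd hh).tsum_eq
  · exact fun j => (hh.comp_add_right (j * d)).aestronglyMeasurable.restrict
  · rw [← lintegral_Ioc_unfold hd fun x => ‖h x‖ₑ]
    exact hh.hasFiniteIntegral.ne

theorem summable_of_tsum_enorm_ne_top {ι E : Type*} [NormedAddCommGroup E] [CompleteSpace E]
    {f : ι → E} (h : ∑' i, ‖f i‖ₑ ≠ ⊤) : Summable f :=
  Summable.of_nnnorm (ENNReal.tsum_coe_ne_top_iff_summable.mp h)

theorem measurable_mul_conj {g h : ℝ → ℂ} (hg : Measurable g) (hh : Measurable h) :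
    Measurable fun x => g x * conj (h x) :=
  hg.mul (Complex.continuous_conj.measurable.comp hh)

/-- The periodisation `∑ g(x + jd)`. -/
def periodize (d : ℝ) (g : ℝ → ℂ) (x : ℝ) : ℂ := ∑' j : ℤ, g (x + j * d)

theorem periodize_add (d : ℝ) (g : ℝ → ℂ) (x : ℝ) (i : ℤ) :
    periodize d g (x + i * d) = periodize d g x := by
  rw [periodize, periodize, ← (Equiv.addLeft i).tsum_eq (fun j : ℤ => g (x + j * d))]
  refine tsum_congr fun j => ?_
  simp only [Equiv.coe_addLeft]
  push_cast
  congr 1; ring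

theorem measurable_periodize {d : ℝ} {g : ℝ → ℂ} (hg : Measurable g) :
    Measurable (periodize d g) :=
  Measurable.tsum fun _ => hg.comp (measurable_id.add_const _)

theorem lintegral_mul_periodize_ne_top {d : ℝ} {g : ℝ → ℂ} (hg : Measurable g)
    (hfin : ∑' j : ℤ, ∫⁻ x, ‖g x‖ₑ * ‖g (x + j * d)‖ₑ ≠ ⊤) :
    ∫⁻ x, ‖g x * conj (periodize d g x)‖ₑ ≠ ⊤ := by
  refine ne_top_of_le_ne_top hfin ?_
  rw [← lintegral_tsum fun _ => by fun_prop]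
  refine lintegral_mono fun x => ?_
  rw [ENNReal.tsum_mul_left, enorm_mul, RCLike.enorm_conj]
  exact mul_le_mul_right enorm_tsum_le_tsum_enorm _

/-- Unfolding one factor bounds `∫ |Pg|²` over a period by `∫ |g||Pg|` over the line, which the
summed correlations control. -/
theorem memLp_periodize {d : ℝ} (hd : 0 < d) {g : ℝ → ℂ} (hg : Measurable g)
    (hfin : ∑' j : ℤ, ∫⁻ x, ‖g x‖ₑ * ‖g (x + j * d)‖ₑ ≠ ⊤) :
    MemLp (periodize d g) 2 (volume.restrict (Set.Ioc 0 d)) := by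
  rw [memLp_two_iff_integrable_sq_norm (measurable_periodize hg).aestronglyMeasurable]
  refine ⟨by have := (measurable_periodize (d := d) hg); fun_prop, ?_⟩
  refine lt_of_le_of_lt ?_ (lintegral_mul_periodize_ne_top hg hfin).lt_top
  have hm (j : ℤ) : AEMeasurable (fun x => ‖g (x + j * d) * conj (periodize d g (x + j * d))‖ₑ)
      (volume.restrict (Set.Ioc 0 d)) :=
    ((measurable_mul_conj hg (measurable_periodize hg)).comp
      (measurable_id.add_const _)).enorm.aemeasurable
  rw [lintegral_Ioc_unfold hd, ← lintegral_tsum hm]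
  refine lintegral_mono fun x => ?_
  simp only [enorm_mul, RCLike.enorm_conj, periodize_add, ENNReal.tsum_mul_right, enorm_pow,
    enorm_norm]
  rw [sq]
  exact mul_le_mul_left enorm_tsum_le_tsum_enorm _

theorem integral_norm_periodize_sq {d : ℝ} (hd : 0 < d) {g : ℝ → ℂ} (hg : Measurable g)
    (hfin : ∑' j : ℤ, ∫⁻ x, ‖g x‖ₑ * ‖g (x + j * d)‖ₑ ≠ ⊤) :
    ((∫ x in Set.Ioc 0 d, ‖periodize d g x‖ ^ 2 : ℝ) : ℂ)
      = ∑' j : ℤ, ∫ x, g x * conj (g (x + j * d)) := by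
  have hG := measurable_periodize (d := d) hg
  have hint : Integrable fun x => g x * conj (periodize d g x) :=
    ⟨(measurable_mul_conj hg hG).aestronglyMeasurable,
      (lintegral_mul_periodize_ne_top hg hfin).lt_top⟩
  have h1 := integral_Ioc_tsum hd hint
  have hm (j : ℤ) : AEStronglyMeasurable (fun x => g x * conj (g (x + j * d))) volume :=
    (measurable_mul_conj hg (hg.comp (measurable_id.add_const _))).aestronglyMeasurable
  rw [← integral_tsum hm
    (by simpa only [enorm_mul, RCLike.enorm_conj]), ← integral_complex_ofReal]
  simp only [tsum_mul_left, ← Complex.conj_tsum]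
  refine Eq.trans ?_ h1
  refine integral_congr_ae (ae_of_all _ fun x => ?_)
  simp only [periodize_add, tsum_mul_right]
  rw [← periodize, Complex.mul_conj, Complex.normSq_eq_norm_sq]

/-- Parseval's identity for the Fourier integrals of `g` at the multiples of `1 / d`. -/
theorem hasSum_norm_sq_integral_exp {d : ℝ} (hd : 0 < d) {g : ℝ → ℂ} (hg : Measurable g)
    (hint : Integrable g)
    (hfin : ∑' j : ℤ, ∫⁻ x, ‖g x‖ₑ * ‖g (x + j * d)‖ₑ ≠ ⊤) :
    HasSum (fun l : ℤ => ‖∫ x : ℝ, Complex.exp (-(2 * Real.pi * Complex.I * (l / d) * x)) * g x‖ ^ 2)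
      (d * (∑' j : ℤ, ∫ x, g x * conj (g (x + j * d))).re) := by
  have h1 := hasSum_sq_fourierCoeffOn hd (memLp_periodize hd hg hfin)
  have hd' : (d : ℂ) ≠ 0 := by exact_mod_cast hd.ne'
  -- The exponential of frequency `l/d` is `d`-periodic, so it passes through the periodisation:
  -- Fourier coefficients over a period are `1/d` times Fourier integrals over the line.
  have hcoef (l : ℤ) : ∫ x : ℝ, Complex.exp (-(2 * Real.pi * Complex.I * (l / d) * x)) * g x
      = d * fourierCoeffOn hd (periodize d g) l := by
    have hm : Integrable fun x : ℝ =>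
        Complex.exp (-(2 * Real.pi * Complex.I * (l / d) * x)) * g x := by
      refine hint.bdd_mul (c := 1) (Continuous.aestronglyMeasurable (by fun_prop))
        (ae_of_all _ fun x => ?_)
      rw [Complex.norm_exp]
      simp [← Complex.ofReal_intCast, ← Complex.ofReal_div]
    rw [fourierCoeffOn_eq_integral, intervalIntegral.integral_of_le hd.le,
      ← integral_Ioc_tsum hd hm, sub_zero, Complex.real_smul, Complex.ofReal_div,
      Complex.ofReal_one, ← mul_assoc, mul_one_div_cancel hd', one_mul]
    refine integral_congr_ae (ae_of_all _ fun x => ?_)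
    simp only [smul_eq_mul]
    rw [periodize, ← tsum_mul_left]
    refine tsum_congr fun j => ?_
    rw [fourier_coe_apply]
    congr 1
    refine Complex.exp_eq_exp_iff_exists_int.mpr ⟨-(l * j), ?_⟩
    push_cast
    field_simp
    ring
  have h2 := h1.mul_left (d ^ 2)
  rw [← integral_norm_periodize_sq hd hg hfin, Complex.ofReal_re]
  rw [intervalIntegral.integral_of_le hd.le, sub_zero, smul_eq_mul,
    show d ^ 2 * (d⁻¹ * ∫ x in Set.Ioc 0 d, ‖periodize d g x‖ ^ 2)
      = d * ∫ x in Set.Ioc 0 d, ‖periodize d g x‖ ^ 2 by field_simp] at h2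
  refine h2.congr_fun fun l => ?_
  rw [hcoef, norm_mul, mul_pow, Complex.norm_real, Real.norm_eq_abs, sq_abs]

end GaborAGM
end

noncomputable section

namespace GaborAGM

open Filter Topology
open scoped ENNReal ComplexConjugate

/-! ### The frame identity -/

/-- The normalised Gaussian as a real function. -/
def realGaussian (t : ℝ) : ℝ := (2 : ℝ) ^ (1 / 4 : ℝ) * Real.exp (-Real.pi * t ^ 2)

theorem realGaussian_nonneg (t : ℝ) : 0 ≤ realGaussian t := by
  unfold realGaussian; positivity

theorem enorm_realGaussian (t : ℝ) : ‖(realGaussian t : ℂ)‖ₑ = ENNReal.ofReal (realGaussian t) := by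
  rw [← ofReal_norm, Complex.norm_real, Real.norm_of_nonneg (realGaussian_nonneg t)]

theorem continuous_realGaussian : Continuous realGaussian := by
  unfold realGaussian; fun_prop

/-- Centres `k/d` and `k/d - jd` contribute `e^{-πj²d²/2}` times a squared Gaussian at their
midpoint. The midpoint is `(k - jN)/d` because `d² = 2N`; this is where even density enters. -/
theorem realGaussian_mul {d : ℝ} (hd : 0 < d) {N : ℕ} (hN : d ^ 2 = 2 * N) (x : ℝ) (j k : ℤ) :
    realGaussian (x - k / d) * realGaussian (x + j * d - k / d)
      = d * sqNome d ^ (j ^ 2)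
        * (√2 / d * Real.exp (-2 * Real.pi * (x - ((k - j * N : ℤ) : ℝ) / d) ^ 2)) := by
  have h2 : (2 : ℝ) ^ (1 / 4 : ℝ) * (2 : ℝ) ^ (1 / 4 : ℝ) = √2 := by
    rw [← Real.rpow_add two_pos, Real.sqrt_eq_rpow]; norm_num
  have he : Real.exp (-Real.pi * (x - k / d) ^ 2) * Real.exp (-Real.pi * (x + j * d - k / d) ^ 2)
      = sqNome d ^ (j ^ 2) * Real.exp (-2 * Real.pi * (x - ((k - j * N : ℤ) : ℝ) / d) ^ 2) := by
    rw [sqNome, ← Real.rpow_intCast, ← Real.exp_mul, ← Real.exp_add, ← Real.exp_add]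
    congr 1
    push_cast
    have hN' : (N : ℝ) = d ^ 2 / 2 := by linarith
    rw [hN']
    field_simp
    ring
  calc _ = ((2 : ℝ) ^ (1 / 4 : ℝ) * (2 : ℝ) ^ (1 / 4 : ℝ)) *
        (Real.exp (-Real.pi * (x - k / d) ^ 2) * Real.exp (-Real.pi * (x + j * d - k / d) ^ 2)) := by
        simp only [realGaussian]; ring
    _ = _ := by
        rw [h2, he]; field_simp

/-- Reindexing `k` absorbs the shift `jN`, so the same weight appears for every `j`. -/
theorem hasSum_realGaussian_mul {d : ℝ} (hd : 0 < d) {N : ℕ} (hN : d ^ 2 = 2 * N) (x : ℝ) (j : ℤ) :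
    HasSum (fun k : ℤ => realGaussian (x - k / d) * realGaussian (x + j * d - k / d))
      (d * sqNome d ^ (j ^ 2) * weight d x) := by
  simp only [realGaussian_mul hd hN]
  exact ((Equiv.subRight (j * N : ℤ)).hasSum_iff.mpr (hasSum_weight hd x)).mul_left _

theorem inner_gaborAtom (x₀ ω : ℝ) (f : L2) :
    (inner ℂ (gaborAtom (x₀, ω)) f : ℂ)
      = ∫ x : ℝ, Complex.exp (-(2 * Real.pi * Complex.I * ω * x))
        * ((realGaussian (x - x₀) : ℂ) * f x) := by
  rw [L2.inner_def]
  refine integral_congr_ae ?_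
  filter_upwards [(memLp_timeFreqShift (x₀, ω) memLp_gaussian).coeFn_toLp] with x hx
  rw [gaborAtom, hx, RCLike.inner_apply, timeFreqShift, map_mul, ← Complex.exp_conj]
  have h1 : conj (gaussian (x - x₀)) = (realGaussian (x - x₀) : ℂ) := Complex.conj_ofReal _
  rw [h1]
  have h2 : conj (2 * Real.pi * Complex.I * ω * x : ℂ) = -(2 * Real.pi * Complex.I * ω * x) := by
    rw [show (2 * Real.pi * Complex.I * ω * x : ℂ) = ((2 * Real.pi * ω * x : ℝ) : ℂ) * Complex.I by
      push_cast; ring, map_mul, Complex.conj_ofReal, Complex.conj_I, mul_neg]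
  rw [h2]; ring

/-- `f` windowed by the Gaussian at `k / d`. -/
def windowed (d : ℝ) (f : L2) (k : ℤ) (x : ℝ) : ℂ := (realGaussian (x - k / d) : ℂ) * f x

theorem measurable_coeFn (f : L2) : Measurable f := (Lp.stronglyMeasurable f).measurable

theorem measurable_windowed (d : ℝ) (f : L2) (k : ℤ) : Measurable (windowed d f k) := by
  refine Measurable.mul ?_ (measurable_coeFn f)
  exact (Continuous.measurable (by have := continuous_realGaussian; fun_prop))

theorem integrable_windowed (d : ℝ) (f : L2) (k : ℤ) : Integrable (windowed d f k) := by
  have h : MemLp (fun x : ℝ => (realGaussian (x - k / d) : ℂ)) 2 :=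
    memLp_gaussian.comp_measurePreserving (measurePreserving_sub_right volume (k / d))
  exact h.integrable_mul (Lp.memLp f)

theorem windowed_mul_conj (d : ℝ) (f : L2) (j k : ℤ) (x : ℝ) :
    windowed d f k x * conj (windowed d f k (x + j * d))
      = ((realGaussian (x - k / d) * realGaussian (x + j * d - k / d) : ℝ) : ℂ)
        * (f x * conj (f (x + j * d))) := by
  simp only [windowed, map_mul, Complex.conj_ofReal]
  push_cast; ring

theorem lintegral_enorm_sq_ne_top (f : L2) : ∫⁻ x, ‖f x‖ₑ ^ 2 ≠ ⊤ := by
  have h := ((memLp_two_iff_integrable_sq_norm (Lp.aestronglyMeasurable f)).mp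
    (Lp.memLp f)).hasFiniteIntegral
  simpa only [HasFiniteIntegral, enorm_pow, enorm_norm] using h.ne

/-- This absolute convergence, valid for every `f` in `L²`, justifies all later interchanges. The
factor `q^{j²}` sums over `j`, and the product of values of `f` is at most the sum of their squares.
-/
theorem tsum_lintegral_windowed_ne_top {d : ℝ} (hd : 0 < d) {N : ℕ} (hN : d ^ 2 = 2 * N)
    (hW : ∀ x, 0 ≤ weight d x) (f : L2) :
    ∑' (j : ℤ) (k : ℤ), ∫⁻ x, ‖windowed d f k x‖ₑ * ‖windowed d f k (x + j * d)‖ₑ ≠ ⊤ := by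
  have hq := (sqNome_pos d).le
  set M := ∫⁻ x, ‖f x‖ₑ ^ 2 with hM
  have hθ : 0 ≤ jtheta 1 (sqNome d) := (hW 0).trans (weight_le hd 0)
  have hle (j : ℤ) : ∑' k : ℤ, ∫⁻ x, ‖windowed d f k x‖ₑ * ‖windowed d f k (x + j * d)‖ₑ
      ≤ ENNReal.ofReal (sqNome d ^ (j ^ 2) * (d * jtheta 1 (sqNome d))) * (M + M) := by
    have hm (k : ℤ) : AEMeasurable (fun x => ‖windowed d f k x‖ₑ * ‖windowed d f k (x + j * d)‖ₑ)
        volume :=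
      ((measurable_windowed d f k).enorm.mul
        ((measurable_windowed d f k).comp (measurable_id.add_const _)).enorm).aemeasurable
    rw [← lintegral_tsum hm]
    have hsh : ∫⁻ x, ‖f (x + j * d)‖ₑ ^ 2 = M :=
      lintegral_add_right_eq_self (fun x => ‖f x‖ₑ ^ 2) (j * d)
    have hfm := measurable_coeFn f
    calc ∫⁻ x, ∑' k : ℤ, ‖windowed d f k x‖ₑ * ‖windowed d f k (x + j * d)‖ₑ
        ≤ ∫⁻ x, ENNReal.ofReal (sqNome d ^ (j ^ 2) * (d * jtheta 1 (sqNome d)))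
          * (‖f x‖ₑ ^ 2 + ‖f (x + j * d)‖ₑ ^ 2) := by
          refine lintegral_mono fun x => ?_
          have e (k : ℤ) : ‖windowed d f k x‖ₑ * ‖windowed d f k (x + j * d)‖ₑ
              = ENNReal.ofReal (realGaussian (x - k / d) * realGaussian (x + j * d - k / d))
                * (‖f x‖ₑ * ‖f (x + j * d)‖ₑ) := by
            rw [windowed, windowed, enorm_mul, enorm_mul,
              ENNReal.ofReal_mul (realGaussian_nonneg _), enorm_realGaussian, enorm_realGaussian]
            ring
          have hs := hasSum_realGaussian_mul hd hN x j
          simp only [e]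
          rw [ENNReal.tsum_mul_right, ← ENNReal.ofReal_tsum_of_nonneg (fun k =>
            mul_nonneg (realGaussian_nonneg _) (realGaussian_nonneg _)) hs.summable, hs.tsum_eq]
          refine mul_le_mul' (ENNReal.ofReal_le_ofReal ?_) ?_
          · have := weight_le hd x
            calc d * sqNome d ^ (j ^ 2) * weight d x
                ≤ d * sqNome d ^ (j ^ 2) * jtheta 1 (sqNome d) := by gcongr
              _ = _ := by ring
          · rcases le_total ‖f x‖ₑ ‖f (x + j * d)‖ₑ with h | h
            · exact (mul_le_mul_left h _).trans (by rw [← sq]; exact le_add_self)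
            · exact (mul_le_mul_right h _).trans (by rw [← sq]; exact le_self_add)
      _ = _ := by
          rw [lintegral_const_mul _ (by fun_prop), lintegral_add_left (by fun_prop), hsh, hM]
  refine ne_top_of_le_ne_top ?_ (ENNReal.tsum_le_tsum hle)
  rw [ENNReal.tsum_mul_right]
  refine ENNReal.mul_ne_top ?_ (ENNReal.add_ne_top.mpr
    ⟨lintegral_enorm_sq_ne_top f, lintegral_enorm_sq_ne_top f⟩)
  exact ((summable_zpow_sq hq (sqNome_lt_one hd)).mul_right _).tsum_ofReal_ne_top

theorem abs_sqrt_weight_le {d : ℝ} (hd : 0 < d) (x : ℝ) :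
    |√(weight d x)| ≤ √(jtheta 1 (sqNome d)) := by
  rw [abs_of_nonneg (Real.sqrt_nonneg _)]
  exact Real.sqrt_le_sqrt (weight_le hd x)

/-- Multiplication by the square root of the weight. -/
def weightMul {d : ℝ} (hd : 0 < d) : L2 →ₗ[ℂ] L2 :=
  mulBdd (fun x => √(weight d x)) (continuous_weight hd).sqrt _ (abs_sqrt_weight_le hd)

theorem weight_add_mul {d : ℝ} (hd : 0 < d) {N : ℕ} (hN : d ^ 2 = 2 * N) (x : ℝ) (j : ℤ) :
    weight d (x + j * d) = weight d x := by
  rw [show (j : ℝ) * d = ((j * (2 * N) : ℤ) : ℝ) / d by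
    push_cast; rw [← hN]; field_simp]
  exact weight_add_div hd x _

/-- Translation by `d` fixes the weight, so it splits evenly as `√w · √w` between the two arguments.
-/
theorem inner_translate_weightMul {d : ℝ} (hd : 0 < d) {N : ℕ} (hN : d ^ 2 = 2 * N)
    (hW : ∀ x, 0 ≤ weight d x) (f : L2) (j : ℤ) :
    (inner ℂ ((translate d ^ j) (weightMul hd f)) (weightMul hd f) : ℂ)
      = ∫ x, (weight d x : ℂ) * (f x * conj (f (x + j * d))) := by
  rw [translate_zpow, L2.inner_def]
  refine integral_congr_ae ?_
  have hc := coeFn_mulBdd (continuous_weight hd).sqrt (abs_sqrt_weight_le hd) f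
  filter_upwards [coeFn_translate (j * d) (weightMul hd f), hc,
    (measurePreserving_add_right volume (j * d)).quasiMeasurePreserving.ae hc] with x h1 h2 h3
  rw [RCLike.inner_apply, h1, weightMul, h2, h3, weight_add_mul hd hN, map_mul, Complex.conj_ofReal]
  have : ((√(weight d x) : ℝ) : ℂ) * ((√(weight d x) : ℝ) : ℂ) = (weight d x : ℂ) := by
    rw [← Complex.ofReal_mul, Real.mul_self_sqrt (hW x)]
  rw [← this]; ring

/-- The frame coefficients over the square lattice of mesh `1 / d` are square summable and their
energy is a theta sum of translations (the Janssen representation). -/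
theorem hasSum_norm_sq_inner_gaborAtom {d : ℝ} (hd : 0 < d) {N : ℕ} (hN : d ^ 2 = 2 * N)
    (hW : ∀ x, 0 ≤ weight d x) (f : L2) :
    HasSum (fun p : ℤ × ℤ => ‖(inner ℂ (gaborAtom (p.1 / d, p.2 / d)) f : ℂ)‖ ^ 2)
      (d ^ 2 * thetaForm (sqNome d) (translate d) (weightMul hd f)) := by
  have hE := tsum_lintegral_windowed_ne_top hd hN hW f
  have hE' := hE
  rw [ENNReal.tsum_comm] at hE'
  set c : ℤ → ℤ → ℂ := fun k j => ∫ x, windowed d f k x * conj (windowed d f k (x + j * d)) with hc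
  -- At fixed time `k/d`, Parseval sums over the frequencies.
  have hrow (k : ℤ) : HasSum
      (fun l : ℤ => ‖(inner ℂ (gaborAtom (k / d, l / d)) f : ℂ)‖ ^ 2) (d * (∑' j, c k j).re) := by
    have h := hasSum_norm_sq_integral_exp hd (measurable_windowed d f k) (integrable_windowed d f k)
      (ENNReal.ne_top_of_tsum_ne_top hE' k)
    refine h.congr_fun fun l => ?_
    rw [inner_gaborAtom]
    push_cast
    rfl
  have hsum : Summable fun p : ℤ × ℤ => c p.1 p.2 := by
    refine summable_of_tsum_enorm_ne_top (ne_top_of_le_ne_top hE' ?_)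
    rw [ENNReal.tsum_prod']
    refine ENNReal.tsum_le_tsum fun k => ENNReal.tsum_le_tsum fun j => ?_
    refine (enorm_integral_le_lintegral_enorm _).trans_eq ?_
    simp only [enorm_mul, RCLike.enorm_conj]
  -- At fixed correlation shift `jd`, the sum over times produces the weight.
  have hcol (j : ℤ) : ∑' k, c k j = ((d * sqNome d ^ (j ^ 2) : ℝ) : ℂ)
      * inner ℂ ((translate d ^ j) (weightMul hd f)) (weightMul hd f) := by
    rw [inner_translate_weightMul hd hN hW, ← integral_const_mul, hc]
    have hm (k : ℤ) : AEStronglyMeasurable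
        (fun x => windowed d f k x * conj (windowed d f k (x + j * d))) volume :=
      (measurable_mul_conj (measurable_windowed d f k)
        ((measurable_windowed d f k).comp (measurable_id.add_const _))).aestronglyMeasurable
    rw [← integral_tsum hm (by
      simpa only [enorm_mul, RCLike.enorm_conj] using ENNReal.ne_top_of_tsum_ne_top hE j)]
    refine integral_congr_ae (ae_of_all _ fun x => ?_)
    simp only [windowed_mul_conj]
    rw [tsum_mul_right, ← Complex.ofReal_tsum, (hasSum_realGaussian_mul hd hN x j).tsum_eq]
    push_cast; ring
  have htot : HasSum (fun k => d * (∑' j, c k j).re)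
      (d ^ 2 * thetaForm (sqNome d) (translate d) (weightMul hd f)) := by
    have h1 : HasSum (fun k => ∑' j, c k j) (∑' k, ∑' j, c k j) := hsum.prod.hasSum
    rw [← Summable.tsum_comm (f := c) hsum, tsum_congr hcol] at h1
    have h2 := (Complex.hasSum_re h1).mul_left d
    suffices hval : d ^ 2 * thetaForm (sqNome d) (translate d) (weightMul hd f)
        = d * (∑' j : ℤ, ((d * sqNome d ^ (j ^ 2) : ℝ) : ℂ)
          * inner ℂ ((translate d ^ j) (weightMul hd f)) (weightMul hd f)).re by
      rw [hval]; exact h2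
    rw [Complex.re_tsum, thetaForm, ← tsum_mul_left, ← tsum_mul_left]
    · refine tsum_congr fun j => ?_
      rw [Complex.re_ofReal_mul, RCLike.re_to_complex]
      ring
    · have := (hsum.prod_symm.prod)
      simpa only [Prod.swap, hcol] using this
  have hs : Summable fun p : ℤ × ℤ => ‖(inner ℂ (gaborAtom (p.1 / d, p.2 / d)) f : ℂ)‖ ^ 2 := by
    rw [summable_prod_of_nonneg fun _ => sq_nonneg _]
    refine ⟨fun k => (hrow k).summable, ?_⟩
    simp only [fun k => (hrow k).tsum_eq]
    exact htot.summable
  have := hs.hasSum.prod_fiberwise hrow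
  rw [htot.unique this]
  exact hs.hasSum

end GaborAGM
end

noncomputable section

namespace GaborAGM

open Filter Topology
open scoped ENNReal ComplexConjugate

/-! ### Sharpness of the bounds -/

theorem weightMul_translate_zpow {d : ℝ} (hd : 0 < d) {N : ℕ} (hN : d ^ 2 = 2 * N) (j : ℤ)
    (f : L2) : weightMul hd ((translate d ^ j) f) = (translate d ^ j) (weightMul hd f) := by
  rw [translate_zpow]
  exact mulBdd_translate _ _ (fun x => by rw [weight_add_mul hd hN]) f

/-- The indicator function of the interval `(x₀, x₀ + ε)`. -/
def bump (x₀ ε : ℝ) : L2 :=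
  indicatorConstLp 2 (measurableSet_Ioo (a := x₀) (b := x₀ + ε)) (by simp) 1

theorem coeFn_bump (x₀ ε : ℝ) :
    bump x₀ ε =ᵐ[volume] (Set.Ioo x₀ (x₀ + ε)).indicator fun _ => 1 := indicatorConstLp_coeFn

theorem norm_bump_sq_pos {x₀ ε : ℝ} (hε : 0 < ε) : 0 < ‖bump x₀ ε‖ ^ 2 := by
  rw [bump, norm_indicatorConstLp (by norm_num) (by norm_num)]
  simp only [Measure.real, Real.volume_Ioo]
  rw [norm_one, one_mul, add_sub_cancel_left, ENNReal.toReal_ofReal hε.le]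
  positivity

theorem bump_mul_conj_translate {d x₀ ε : ℝ} (hd : 0 < d) (hεd : ε ≤ d) {j : ℤ} (hj : j ≠ 0) :
    ∀ᵐ x, bump x₀ ε x * conj (bump x₀ ε (x + j * d)) = 0 := by
  have hc := coeFn_bump x₀ ε
  filter_upwards [hc, (measurePreserving_add_right volume (j * d)).quasiMeasurePreserving.ae hc]
    with x h1 h2
  rw [h1, h2]
  by_cases hx : x ∈ Set.Ioo x₀ (x₀ + ε)
  · have hx' : x + j * d ∉ Set.Ioo x₀ (x₀ + ε) := by
      rintro ⟨h3, h4⟩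
      rcases lt_or_gt_of_ne hj with h | h
      · have : (j : ℝ) ≤ -1 := by exact_mod_cast Int.le_sub_one_of_lt h
        nlinarith [hx.2]
      · have : (1 : ℝ) ≤ j := by exact_mod_cast h
        nlinarith [hx.1]
    rw [Set.indicator_of_notMem hx', map_zero, mul_zero]
  · rw [Set.indicator_of_notMem hx, zero_mul]

theorem inner_translate_bump {d x₀ ε : ℝ} (hd : 0 < d) (hεd : ε ≤ d) {j : ℤ} (hj : j ≠ 0) :
    inner ℂ ((translate d ^ j) (bump x₀ ε)) (bump x₀ ε) = 0 := by
  rw [translate_zpow, L2.inner_def]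
  refine integral_eq_zero_of_ae ?_
  filter_upwards [coeFn_translate (j * d) (bump x₀ ε), bump_mul_conj_translate hd hεd hj]
    with x h1 h2
  rw [RCLike.inner_apply, h1, h2, Pi.zero_apply]

theorem inner_translate_weightMul_bump {d x₀ ε : ℝ} (hd : 0 < d) {N : ℕ} (hN : d ^ 2 = 2 * N)
    (hW : ∀ x, 0 ≤ weight d x) (hεd : ε ≤ d) {j : ℤ} (hj : j ≠ 0) :
    inner ℂ ((translate d ^ j) (weightMul hd (bump x₀ ε))) (weightMul hd (bump x₀ ε)) = 0 := by
  rw [inner_translate_weightMul hd hN hW]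
  refine integral_eq_zero_of_ae ?_
  filter_upwards [bump_mul_conj_translate hd hεd hj] with x h2
  rw [h2, mul_zero, Pi.zero_apply]

theorem norm_weightMul_sq {d : ℝ} (hd : 0 < d) (hW : ∀ x, 0 ≤ weight d x) (f : L2) :
    ‖weightMul hd f‖ ^ 2 = ∫ x, weight d x * ‖f x‖ ^ 2 := by
  rw [weightMul, norm_mulBdd_sq]
  simp only [Real.sq_sqrt (hW _)]

theorem integrable_norm_sq (f : L2) : Integrable fun x => ‖f x‖ ^ 2 :=
  (memLp_two_iff_integrable_sq_norm (Lp.aestronglyMeasurable f)).mp (Lp.memLp f)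

theorem integrable_weight_mul_norm_sq {d : ℝ} (hd : 0 < d) (hW : ∀ x, 0 ≤ weight d x) (f : L2) :
    Integrable fun x => weight d x * ‖f x‖ ^ 2 :=
  (integrable_norm_sq f).bdd_mul (c := jtheta 1 (sqNome d))
    (continuous_weight hd).aestronglyMeasurable
    (ae_of_all _ fun x => by rw [Real.norm_of_nonneg (hW x)]; exact weight_le hd x)

theorem abs_norm_weightMul_bump_sq_sub_le {d x₀ ε η : ℝ} (hd : 0 < d) (hW : ∀ x, 0 ≤ weight d x)
    (hη : ∀ x ∈ Set.Ioo x₀ (x₀ + ε), |weight d x - weight d x₀| ≤ η) :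
    |‖weightMul hd (bump x₀ ε)‖ ^ 2 - weight d x₀ * ‖bump x₀ ε‖ ^ 2| ≤ η * ‖bump x₀ ε‖ ^ 2 := by
  rw [norm_weightMul_sq hd hW, norm_sq_eq_integral, ← integral_const_mul, ← integral_const_mul,
    ← integral_sub (integrable_weight_mul_norm_sq hd hW _) ((integrable_norm_sq _).const_mul _),
    ← Real.norm_eq_abs]
  refine norm_integral_le_of_norm_le ((integrable_norm_sq _).const_mul _) ?_
  filter_upwards [coeFn_bump x₀ ε] with x hx
  rw [← sub_mul, norm_mul, Real.norm_eq_abs, Real.norm_of_nonneg (sq_nonneg _), hx]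
  by_cases h : x ∈ Set.Ioo x₀ (x₀ + ε)
  · exact mul_le_mul_of_nonneg_right (hη x h) (sq_nonneg _)
  · rw [Set.indicator_of_notMem h]; simp

/-- Every product of a value of the weight and of a theta constant is an approximate value of
the normalised frame form. -/
theorem exists_thetaForm_near {d : ℝ} (hd : 0 < d) {N : ℕ} (hN : d ^ 2 = 2 * N)
    (hW : ∀ x, 0 ≤ weight d x) {s : ℝ} (hs : s ^ 2 = 1) (x₀ : ℝ) {η : ℝ} (hη : 0 < η) :
    ∃ f : L2, 0 < ‖f‖ ^ 2 ∧
      |thetaForm (sqNome d) (translate d) (weightMul hd f)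
        - jtheta s (sqNome d) * weight d x₀ * ‖f‖ ^ 2| ≤ η * ‖f‖ ^ 2 := by
  set q := sqNome d with hq
  have hq0 : 0 ≤ q := (sqNome_pos d).le
  have hq1 : q < 1 := sqNome_lt_one hd
  set C := ∑' j : ℤ, (j : ℝ) ^ 2 * q ^ (j ^ 2) with hC
  have hC0 : 0 ≤ C := tsum_nonneg fun j => mul_nonneg (sq_nonneg _) (zpow_nonneg hq0 _)
  set θ := jtheta s q with hθ
  -- Half of `η` pays for the variation of the weight on the bump, amplified by `|θ|`; the other
  -- half pays for the ends of the orbit sum.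
  set η' := η / (2 * (|θ| + 1)) with hη'
  have hθ0 := abs_nonneg θ
  have hη'0 : 0 < η' := by positivity
  have hθη : |θ| * η' ≤ η / 2 := by
    rw [hη', mul_div_assoc', div_le_div_iff₀ (by positivity) (by positivity)]
    nlinarith
  obtain ⟨ρ, hρ, hcont⟩ := Metric.continuousAt_iff.mp
    ((continuous_weight hd).continuousAt (x := x₀)) η' hη'0
  -- Width at most `ρ` localises the weight; width at most `d` makes the translates disjoint, so the
  -- bump is wandering.
  set ε := min ρ d with hε
  have hε0 : 0 < ε := lt_min hρ hd
  have hclose : ∀ x ∈ Set.Ioo x₀ (x₀ + ε), |weight d x - weight d x₀| ≤ η' := fun x hx => by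
    refine (hcont ?_).le
    rw [Real.dist_eq, abs_of_pos (sub_pos.mpr hx.1)]
    linarith [hx.2, min_le_left ρ d]
  set u := bump x₀ ε with hu
  set v := weightMul hd u with hv
  have hu0 : 0 < ‖u‖ ^ 2 := norm_bump_sq_pos hε0
  have hvu : |‖v‖ ^ 2 - weight d x₀ * ‖u‖ ^ 2| ≤ η' * ‖u‖ ^ 2 :=
    abs_norm_weightMul_bump_sq_sub_le hd hW hclose
  obtain ⟨V, hV⟩ := exists_sign_twist (translate d) hs
  -- The end error `4C‖v‖²` does not depend on `M`, while `‖f‖² = M‖u‖²`.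
  obtain ⟨M, hM⟩ := exists_nat_gt (C * 4 * (weight d x₀ + η') / (η / 2))
  have hM0 : (0 : ℝ) < M :=
    (div_nonneg (mul_nonneg (by positivity) (add_nonneg (hW _) hη'0.le)) (by positivity)).trans_lt hM
  rw [div_lt_iff₀ (by positivity)] at hM
  have huV : ∀ j : ℤ, j ≠ 0 → inner ℂ ((V ^ j) u) u = 0 := fun j hj => by
    rw [hV, inner_smul_left, inner_translate_bump hd (min_le_right _ _) hj, mul_zero]
  have hnf := norm_sq_sum_pow V huV M
  have hWf : weightMul hd (∑ i ∈ Finset.range M, (V ^ i) u)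
      = ∑ i ∈ Finset.range M, (V ^ i) v := by
    rw [map_sum]
    refine Finset.sum_congr rfl fun i _ => ?_
    rw [← zpow_natCast, hV, hV, map_smul, weightMul_translate_zpow hd hN]
  have hT := abs_thetaForm_sum_pow_sub_le hq0 hq1 hs hV
    (fun j hj => inner_translate_weightMul_bump hd hN hW (min_le_right ρ d) hj (x₀ := x₀)) M
  refine ⟨∑ i ∈ Finset.range M, (V ^ i) u, by rw [hnf]; positivity, ?_⟩
  rw [hWf, hnf]
  have hv1 : ‖v‖ ^ 2 ≤ (weight d x₀ + η') * ‖u‖ ^ 2 := by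
    linarith [(abs_le.mp hvu).2]
  have e : thetaForm q (translate d) (∑ i ∈ Finset.range M, (V ^ i) v)
        - θ * weight d x₀ * (M * ‖u‖ ^ 2)
      = (thetaForm q (translate d) (∑ i ∈ Finset.range M, (V ^ i) v) - θ * (M * ‖v‖ ^ 2))
        + θ * M * (‖v‖ ^ 2 - weight d x₀ * ‖u‖ ^ 2) := by ring
  rw [e]
  refine (abs_add_le _ _).trans ?_
  have h1 : C * (4 * ‖v‖ ^ 2) ≤ η / 2 * (M * ‖u‖ ^ 2) := by
    calc C * (4 * ‖v‖ ^ 2) ≤ C * (4 * ((weight d x₀ + η') * ‖u‖ ^ 2)) := by gcongr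
      _ = C * 4 * (weight d x₀ + η') * ‖u‖ ^ 2 := by ring
      _ ≤ M * (η / 2) * ‖u‖ ^ 2 := by gcongr
      _ = _ := by ring
  have h2 : |θ * M * (‖v‖ ^ 2 - weight d x₀ * ‖u‖ ^ 2)| ≤ η / 2 * (M * ‖u‖ ^ 2) := by
    rw [abs_mul, abs_mul, abs_of_pos hM0]
    calc |θ| * M * |‖v‖ ^ 2 - weight d x₀ * ‖u‖ ^ 2| ≤ |θ| * M * (η' * ‖u‖ ^ 2) := by gcongr
      _ = |θ| * η' * (M * ‖u‖ ^ 2) := by ring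
      _ ≤ _ := by gcongr
  linarith

/-! ### Bounds of the frame form -/

theorem thetaForm_weightMul_le {d : ℝ} (hd : 0 < d) (hW : ∀ x, 0 ≤ weight d x) (f : L2) :
    thetaForm (sqNome d) (translate d) (weightMul hd f) ≤ jtheta 1 (sqNome d) ^ 2 * ‖f‖ ^ 2 := by
  have hθ : 0 ≤ jtheta 1 (sqNome d) := (hW 0).trans (weight_le hd 0)
  refine (thetaForm_le (sqNome_pos d).le (sqNome_lt_one hd) _ _).trans ?_
  rw [sq (jtheta _ _), mul_assoc]
  refine mul_le_mul_of_nonneg_left ?_ hθ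
  rw [norm_weightMul_sq hd hW, norm_sq_eq_integral, ← integral_const_mul]
  refine integral_mono (integrable_weight_mul_norm_sq hd hW f)
    ((integrable_norm_sq f).const_mul _) fun x => ?_
  exact mul_le_mul_of_nonneg_right (weight_le hd x) (sq_nonneg _)

theorem le_thetaForm_weightMul {d : ℝ} (hd : 0 < d) (hq : sqNome d ≤ 1 / 16) (f : L2) :
    jtheta (-1) (sqNome d) ^ 2 * ‖f‖ ^ 2
      ≤ thetaForm (sqNome d) (translate d) (weightMul hd f) := by
  have hθ := jtheta_neg_one_nonneg (sqNome_pos d) (sqNome_lt_one hd)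
  have hW : ∀ x, 0 ≤ weight d x := fun x => hθ.trans (le_weight hq x)
  refine le_trans ?_ (le_thetaForm (sqNome_pos d).le hq _ _)
  rw [sq (jtheta _ _), mul_assoc]
  refine mul_le_mul_of_nonneg_left ?_ hθ
  rw [norm_weightMul_sq hd hW, norm_sq_eq_integral, ← integral_const_mul]
  refine integral_mono ((integrable_norm_sq f).const_mul _)
    (integrable_weight_mul_norm_sq hd hW f) fun x => ?_
  exact mul_le_mul_of_nonneg_right (le_weight hq x) (sq_nonneg _)

end GaborAGM
end

noncomputable section

namespace GaborAGM

open Filter Topology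
open scoped ENNReal ComplexConjugate

/-! ### The lattice -/

/-- Coordinates of the square lattice of mesh `a`. -/
def latticeEquiv {a : ℝ} (ha : a ≠ 0) :
    ℤ × ℤ ≃ ((Submodule.span ℤ {a}).prod (Submodule.span ℤ {a}) : Submodule ℤ (ℝ × ℝ)) :=
  Equiv.ofBijective (fun p => ⟨(p.1 * a, p.2 * a),
      Submodule.mem_prod.mpr ⟨Submodule.mem_span_singleton.mpr ⟨p.1, zsmul_eq_mul _ _⟩,
        Submodule.mem_span_singleton.mpr ⟨p.2, zsmul_eq_mul _ _⟩⟩⟩) <| by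
    constructor
    · rintro ⟨k, l⟩ ⟨k', l'⟩ h
      simpa [ha] using h
    · rintro ⟨⟨x, y⟩, hz⟩
      obtain ⟨hx, hy⟩ := Submodule.mem_prod.mp hz
      obtain ⟨k, rfl⟩ := Submodule.mem_span_singleton.mp hx
      obtain ⟨l, rfl⟩ := Submodule.mem_span_singleton.mp hy
      exact ⟨(k, l), Subtype.ext (Prod.ext (zsmul_eq_mul _ _).symm (zsmul_eq_mul _ _).symm)⟩

theorem covolume_square_lattice {a : ℝ} (ha : 0 < a) :
    ZLattice.covolume ((Submodule.span ℤ {a}).prod (Submodule.span ℤ {a}) : Submodule ℤ (ℝ × ℝ))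
      = a ^ 2 := by
  set L := ((Submodule.span ℤ {a}).prod (Submodule.span ℤ {a}) : Submodule ℤ (ℝ × ℝ)) with hL
  have : Countable L := (latticeEquiv ha.ne').symm.injective.countable
  have hF : IsAddFundamentalDomain L (Set.Ico 0 a ×ˢ Set.Ico 0 a) (volume : Measure (ℝ × ℝ)) := by
    refine IsAddFundamentalDomain.mk' (measurableSet_Ico.prod measurableSet_Ico).nullMeasurableSet
      fun z => ?_
    obtain ⟨k, hk, hk'⟩ := existsUnique_add_zsmul_mem_Ico ha z.1 0
    obtain ⟨l, hl, hl'⟩ := existsUnique_add_zsmul_mem_Ico ha z.2 0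
    rw [zero_add] at hk hl
    simp only [zero_add] at hk' hl'
    refine ⟨latticeEquiv ha.ne' (k, l), ?_, fun g hg => ?_⟩
    · change ((k : ℝ) * a + z.1 ∈ Set.Ico 0 a) ∧ ((l : ℝ) * a + z.2 ∈ Set.Ico 0 a)
      rw [zsmul_eq_mul] at hk hl
      exact ⟨by rwa [add_comm], by rwa [add_comm]⟩
    · obtain ⟨⟨m, n⟩, rfl⟩ := (latticeEquiv ha.ne').surjective g
      have hg' : ((m : ℝ) * a + z.1 ∈ Set.Ico 0 a) ∧ ((n : ℝ) * a + z.2 ∈ Set.Ico 0 a) := hg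
      rw [hk' m (by simpa [add_comm] using hg'.1), hl' n (by simpa [add_comm] using hg'.2)]
  have i1 : MeasurableVAdd L (ℝ × ℝ) := (inferInstance : MeasurableVAdd L.toAddSubgroup (ℝ × ℝ))
  have i2 : VAddInvariantMeasure L (ℝ × ℝ) volume :=
    (inferInstance : VAddInvariantMeasure L.toAddSubgroup (ℝ × ℝ) volume)
  have h := congrArg ENNReal.toReal (hF.covolume_eq_volume volume)
  rw [ZLattice.covolume, h, Measure.volume_eq_prod, Measure.prod_prod, Real.volume_Ico, sub_zero,
    ENNReal.toReal_mul, ENNReal.toReal_ofReal ha.le, sq]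

/-! ### Bessel families -/

section Bessel

variable {ι H : Type*} [NormedAddCommGroup H] [InnerProductSpace ℂ H]

/-- Pairing the finite sum `g` with itself, Cauchy–Schwarz and the Bessel bound at `g` give `‖g‖⁴ ≤
S·C‖g‖²`. -/
theorem norm_sum_smul_sq_le {a : ι → H} {C : ℝ}
    (hC : ∀ f, ∀ t : Finset ι, ∑ i ∈ t, ‖(inner ℂ (a i) f : ℂ)‖ ^ 2 ≤ C * ‖f‖ ^ 2)
    (f : H) (t : Finset ι) :
    ‖∑ i ∈ t, (inner ℂ (a i) f : ℂ) • a i‖ ^ 2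
      ≤ C * ∑ i ∈ t, ‖(inner ℂ (a i) f : ℂ)‖ ^ 2 := by
  set g := ∑ i ∈ t, (inner ℂ (a i) f : ℂ) • a i with hg
  set S := ∑ i ∈ t, ‖(inner ℂ (a i) f : ℂ)‖ ^ 2 with hS
  have hS0 : 0 ≤ S := Finset.sum_nonneg fun i _ => sq_nonneg _
  have h1 : ‖g‖ ^ 2 ≤ ∑ i ∈ t, ‖(inner ℂ (a i) f : ℂ)‖ * ‖(inner ℂ (a i) g : ℂ)‖ := by
    have e : ((‖g‖ ^ 2 : ℝ) : ℂ) = ∑ i ∈ t, (inner ℂ (a i) f : ℂ) * inner ℂ g (a i) := by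
      have := inner_self_eq_norm_sq_to_K (𝕜 := ℂ) g
      rw [Complex.ofReal_pow]
      refine this.symm.trans ?_
      conv_lhs => rw [hg, inner_sum]
      exact Finset.sum_congr rfl fun i _ => inner_smul_right _ _ _
    calc ‖g‖ ^ 2 = ‖((‖g‖ ^ 2 : ℝ) : ℂ)‖ := by
          rw [Complex.norm_real, Real.norm_of_nonneg (sq_nonneg _)]
      _ ≤ ∑ i ∈ t, ‖(inner ℂ (a i) f : ℂ) * inner ℂ g (a i)‖ := by
          rw [e]; exact norm_sum_le _ _
      _ = _ := Finset.sum_congr rfl fun i _ => by rw [norm_mul, norm_inner_symm g]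
  have h2 := Finset.sum_mul_sq_le_sq_mul_sq t (fun i => ‖(inner ℂ (a i) f : ℂ)‖)
    (fun i => ‖(inner ℂ (a i) g : ℂ)‖)
  have h3 : (‖g‖ ^ 2) ^ 2 ≤ S * (C * ‖g‖ ^ 2) :=
    (pow_le_pow_left₀ (sq_nonneg _) h1 2).trans
      (h2.trans (mul_le_mul_of_nonneg_left (hC g t) hS0))
  -- Cancelling `‖g‖²` needs `g ≠ 0`. Otherwise `C·S ≥ 0` is required: `C` is nonnegative when `f ≠
  -- 0`, and `S = 0` when `f = 0`.
  rcases (sq_nonneg ‖g‖).eq_or_lt with h0 | h0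
  · have hCf := (Finset.sum_nonneg fun i _ => sq_nonneg _).trans (hC f t)
    rw [← h0]
    rcases (sq_nonneg ‖f‖).eq_or_lt with hf | hf
    · have : f = 0 := by simpa using hf.symm
      simp [hS, this]
    · exact mul_nonneg (nonneg_of_mul_nonneg_left hCf hf) hS0
  · nlinarith

/-- The synthesis bound transfers the Cauchy criterion from the square-summable coefficients to the
vector series. -/
theorem summable_frame [CompleteSpace H] {a : ι → H} {C : ℝ}
    (hC : ∀ f, ∀ t : Finset ι, ∑ i ∈ t, ‖(inner ℂ (a i) f : ℂ)‖ ^ 2 ≤ C * ‖f‖ ^ 2)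
    (f : H) : Summable fun i => (inner ℂ (a i) f : ℂ) • a i := by
  have hs : Summable fun i => ‖(inner ℂ (a i) f : ℂ)‖ ^ 2 :=
    summable_of_sum_le (fun i => sq_nonneg _) (hC f)
  rw [summable_iff_vanishing_norm] at hs ⊢
  intro ε hε
  obtain ⟨s, hs⟩ := hs (ε ^ 2 / (|C| + 1)) (by positivity)
  refine ⟨s, fun t ht => ?_⟩
  have h1 := hs t ht
  have hS0 : 0 ≤ ∑ i ∈ t, ‖(inner ℂ (a i) f : ℂ)‖ ^ 2 := Finset.sum_nonneg fun i _ => sq_nonneg _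
  rw [Real.norm_of_nonneg hS0, lt_div_iff₀ (by positivity)] at h1
  have h2 := norm_sum_smul_sq_le hC f t
  refine lt_of_pow_lt_pow_left₀ 2 hε.le ?_
  nlinarith [le_abs_self C]

theorem inner_tsum_frame {a : ι → H} {f : H}
    (hs : Summable fun i => (inner ℂ (a i) f : ℂ) • a i) :
    HasSum (fun i => ‖(inner ℂ (a i) f : ℂ)‖ ^ 2)
      (inner ℂ f (∑' i, (inner ℂ (a i) f : ℂ) • a i) : ℂ).re := by
  have h := Complex.hasSum_re (hs.hasSum.mapL (innerSL ℂ f))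
  refine h.congr_fun fun i => ?_
  rw [innerSL_apply_apply, inner_smul_right, ← inner_conj_symm f, Complex.mul_conj,
    Complex.normSq_eq_norm_sq, Complex.ofReal_re]

end Bessel

/-! ### The frame operator over the von Neumann lattice of even density -/

variable {α : ℝ}

theorem mesh_eq (hα : 0 < α) : α ^ (-(1 / 2) : ℝ) = 1 / √α := by
  rw [Real.rpow_neg hα.le, ← Real.sqrt_eq_rpow, one_div]

theorem frame_over_vonNeumann (hα : 0 < α) {N : ℕ} (hN : α = 2 * N)
    (hq : sqNome √α ≤ 1 / 16) (f : L2) :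
    Summable (fun z : vonNeumann α => frameTerm f (z : ℝ × ℝ)) ∧
    (inner ℂ f (frameOperator (vonNeumann α) f) : ℂ).re
      = thetaForm (sqNome √α) (translate √α)
          (weightMul (Real.sqrt_pos.mpr hα) f) := by
  set d := √α with hdα
  have hd : 0 < d := Real.sqrt_pos.mpr hα
  have hd2 : d ^ 2 = α := Real.sq_sqrt hα.le
  have hW : ∀ x, 0 ≤ weight d x := fun x =>
    (jtheta_neg_one_nonneg (sqNome_pos d) (sqNome_lt_one hd)).trans (le_weight hq x)
  have hmesh : α ^ (-(1 / 2) : ℝ) = 1 / d := mesh_eq hα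
  have ha : 0 < α ^ (-(1 / 2) : ℝ) := by positivity
  have hcov : ZLattice.covolume (vonNeumann α) = 1 / d ^ 2 := by
    rw [vonNeumann, covolume_square_lattice ha, hmesh, div_pow, one_pow]
  have hE (g : L2) : HasSum (fun z : vonNeumann α => ‖(inner ℂ (gaborAtom (z : ℝ × ℝ)) g : ℂ)‖ ^ 2)
      (d ^ 2 * thetaForm (sqNome d) (translate d) (weightMul hd g)) := by
    refine (latticeEquiv ha.ne').hasSum_iff.mp ?_
    refine (hasSum_norm_sq_inner_gaborAtom hd (hd2.trans hN) hW g).congr_fun fun p => ?_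
    change ‖(inner ℂ (gaborAtom (p.1 * α ^ (-(1 / 2) : ℝ), p.2 * α ^ (-(1 / 2) : ℝ))) g : ℂ)‖ ^ 2 = _
    rw [hmesh, mul_one_div, mul_one_div]
  have hs := summable_frame (a := fun z : vonNeumann α => gaborAtom (z : ℝ × ℝ))
    (C := d ^ 2 * jtheta 1 (sqNome d) ^ 2) (fun g t =>
      (sum_le_hasSum t (fun i _ => sq_nonneg _) (hE g)).trans (by
        rw [mul_assoc]
        exact mul_le_mul_of_nonneg_left (thetaForm_weightMul_le hd hW g) (sq_nonneg d))) f
  refine ⟨hs, ?_⟩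
  have h := (inner_tsum_frame hs).unique (hE f)
  have e : (inner ℂ f (frameOperator (vonNeumann α) f) : ℂ).re
      = ZLattice.covolume (vonNeumann α)
        * (inner ℂ f (∑' z : vonNeumann α, frameTerm f (z : ℝ × ℝ)) : ℂ).re := by
    rw [frameOperator, inner_smul_right_eq_smul, Complex.smul_re, smul_eq_mul]
  rw [e, hcov]
  refine (congrArg (1 / d ^ 2 * ·) h).trans ?_
  rw [← mul_assoc, one_div_mul_cancel (by positivity), one_mul]

theorem isGreatest_lowerBounds (hα : 0 < α) {N : ℕ} (hN : α = 2 * N)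
    (hq : sqNome √α ≤ 1 / 16) :
    IsGreatest (lowerBounds (vonNeumann α)) (jtheta (-1) (sqNome √α) ^ 2) := by
  have hd : 0 < √α := Real.sqrt_pos.mpr hα
  have hW : ∀ x, 0 ≤ weight √α x := fun x =>
    (jtheta_neg_one_nonneg (sqNome_pos _) (sqNome_lt_one hd)).trans (le_weight hq x)
  constructor
  · intro f
    rw [(frame_over_vonNeumann hα hN hq f).2]
    exact le_thetaForm_weightMul hd hq f
  · intro A hA
    refine le_of_forall_pos_le_add fun η hη => ?_
    -- The weight attains its minimum `θ₄(q)` at `1/(2d)`; with `s = -1` the operator contributes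
    -- the second factor `θ₄(q)`.
    obtain ⟨f, hf, h⟩ := exists_thetaForm_near hd ((Real.sq_sqrt hα.le).trans hN) hW
      (s := -1) (by norm_num) (1 / (2 * √α)) hη
    have h2 := hA f
    rw [(frame_over_vonNeumann hα hN hq f).2] at h2
    rw [weight_half hd] at h
    refine le_of_mul_le_mul_right ?_ hf
    nlinarith [(abs_le.mp h).2]

theorem isLeast_upperBounds (hα : 0 < α) {N : ℕ} (hN : α = 2 * N)
    (hq : sqNome √α ≤ 1 / 16) :
    IsLeast (upperBounds (vonNeumann α)) (jtheta 1 (sqNome √α) ^ 2) := by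
  have hd : 0 < √α := Real.sqrt_pos.mpr hα
  have hW : ∀ x, 0 ≤ weight √α x := fun x =>
    (jtheta_neg_one_nonneg (sqNome_pos _) (sqNome_lt_one hd)).trans (le_weight hq x)
  constructor
  · intro f
    rw [(frame_over_vonNeumann hα hN hq f).2]
    exact thetaForm_weightMul_le hd hW f
  · intro B hB
    refine le_of_forall_pos_le_add fun η hη => ?_
    obtain ⟨f, hf, h⟩ := exists_thetaForm_near hd ((Real.sq_sqrt hα.le).trans hN) hW
      (s := 1) (by norm_num) 0 hη
    have h2 := hB f
    rw [(frame_over_vonNeumann hα hN hq f).2] at h2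
    rw [weight_zero] at h
    refine le_of_mul_le_mul_right ?_ hf
    nlinarith [(abs_le.mp h).1]

theorem sqNome_sqrt_two_pow (n : ℕ) : sqNome √((2 : ℝ) ^ (n + 1)) = nome n := by
  rw [sqNome, nome, Real.sq_sqrt (by positivity), pow_succ]
  congr 1; ring

theorem frame_bounds_two_pow (n : ℕ) :
    (∀ f : L2, Summable fun z : vonNeumann ((2 : ℝ) ^ (n + 1)) => frameTerm f (z : ℝ × ℝ)) ∧
    IsGreatest (lowerBounds (vonNeumann ((2 : ℝ) ^ (n + 1)))) (lowerTheta n) ∧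
    IsLeast (upperBounds (vonNeumann ((2 : ℝ) ^ (n + 1)))) (upperTheta n) := by
  have hα : (0 : ℝ) < 2 ^ (n + 1) := by positivity
  have hN : (2 : ℝ) ^ (n + 1) = 2 * ((2 ^ n : ℕ) : ℝ) := by push_cast; ring
  have hq : sqNome √((2 : ℝ) ^ (n + 1)) ≤ 1 / 16 := by
    rw [sqNome_sqrt_two_pow]; exact nome_le n
  have h1 := isGreatest_lowerBounds hα hN hq
  have h2 := isLeast_upperBounds hα hN hq
  rw [sqNome_sqrt_two_pow] at h1 h2
  exact ⟨fun f => (frame_over_vonNeumann hα hN hq f).1, h1, h2⟩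

theorem specA_two_pow (n : ℕ) : specA ((2 : ℝ) ^ (n + 1)) = lowerTheta n :=
  (frame_bounds_two_pow n).2.1.csSup_eq

theorem specB_two_pow (n : ℕ) : specB ((2 : ℝ) ^ (n + 1)) = upperTheta n :=
  (frame_bounds_two_pow n).2.2.csInf_eq

theorem theta4_eq_jtheta (q : ℝ) : theta4 q = jtheta (-1) q := rfl

end GaborAGM
end

/-! ### The main theorem -/

theorem theorem1 :
    -- the series defining the frame operator converge and the sharp bounds exist
    (∀ n : ℕ, 1 ≤ n →
      (∀ f : GaborAGM.L2, Summable
        fun z : GaborAGM.vonNeumann ((2 : ℝ) ^ n) => GaborAGM.frameTerm f (z : ℝ × ℝ)) ∧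
      IsGreatest (GaborAGM.lowerBounds (GaborAGM.vonNeumann ((2 : ℝ) ^ n)))
        (GaborAGM.specA ((2 : ℝ) ^ n)) ∧
      IsLeast (GaborAGM.upperBounds (GaborAGM.vonNeumann ((2 : ℝ) ^ n)))
        (GaborAGM.specB ((2 : ℝ) ^ n))) ∧
    -- the arithmetic-geometric mean iteration
    (∀ n : ℕ, 1 ≤ n →
      GaborAGM.specB ((2 : ℝ) ^ (n + 1)) =
        (GaborAGM.specA ((2 : ℝ) ^ n) + GaborAGM.specB ((2 : ℝ) ^ n)) / 2 ∧
      GaborAGM.specA ((2 : ℝ) ^ (n + 1)) =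
        √(GaborAGM.specA ((2 : ℝ) ^ n) * GaborAGM.specB ((2 : ℝ) ^ n))) ∧
    -- the values at density 2
    GaborAGM.specB 2 / GaborAGM.specA 2 = √2 ∧
    GaborAGM.specA 2 = GaborAGM.gaussConstant ∧
    GaborAGM.specA 2 = 1 / GaborAGM.agSqrtTwoOne ∧
    GaborAGM.specA 2 = GaborAGM.theta4 (Real.exp (-Real.pi)) ^ 2 ∧
    (0.8346 : ℝ) ≤ GaborAGM.specA 2 ∧ GaborAGM.specA 2 < (0.8347 : ℝ) := by

  have hA2 : GaborAGM.specA 2 = GaborAGM.lowerTheta 0 := by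
    simpa using GaborAGM.specA_two_pow 0
  have hB2 : GaborAGM.specB 2 = GaborAGM.upperTheta 0 := by
    simpa using GaborAGM.specB_two_pow 0
  refine ⟨fun n hn => ?_, fun n hn => ?_, ?_, ?_, ?_, ?_, ?_⟩
  · obtain ⟨m, rfl⟩ := Nat.exists_eq_add_of_le' hn
    rw [GaborAGM.specA_two_pow, GaborAGM.specB_two_pow]
    exact GaborAGM.frame_bounds_two_pow m
  · obtain ⟨m, rfl⟩ := Nat.exists_eq_add_of_le' hn
    simp only [GaborAGM.specA_two_pow, GaborAGM.specB_two_pow]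
    exact ⟨GaborAGM.upperTheta_succ m, GaborAGM.lowerTheta_succ m⟩
  · rw [hA2, hB2, GaborAGM.upperTheta_zero]
    exact mul_div_cancel_right₀ _ GaborAGM.lowerTheta_zero_pos.ne'
  · rw [hA2, GaborAGM.lowerTheta_zero_eq_gaussConstant]
  · rw [hA2, GaborAGM.lowerTheta_zero_eq_agm]
  · rw [hA2, GaborAGM.lowerTheta, GaborAGM.nome_zero, GaborAGM.theta4_eq_jtheta]
  · rw [hA2]
    exact GaborAGM.lowerTheta_zero_bounds
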